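/- Theorem 5.1. Let $(M,g)$ be a smooth oriented Riemannian 3-manifold with Riemannian volume form $\mu$, let $\langle\;,\;\rangle$ be the metric on 1-forms induced by $g$, let $\#:T^*M\to TM$ be the isomorphism given by $g$, and let $\pi$ be a smooth bivector field on $M$. Put $\{f,h\}=\pi(df,dh)$, define $\pi_\#:T^*M\to TM$ by $\gamma(\pi_\#(\beta))=\pi(\beta,\gamma)$, and for 1-forms $\beta,\gamma$ let $$[\beta,\gamma]_\pi=L_{\pi_\#(\beta)}\gamma-L_{\pi_\#(\gamma)}\beta-d(\pi(\beta,\gamma)).$$ Let $\mathcal D$ be the metric contravariant connection associated with $(\pi,g)$, that is, the map on pairs of 1-forms given by $$2\langle\mathcal D_\beta\gamma,\delta\rangle=\pi_\#(\beta).\langle\gamma,\delta\rangle+\pi_\#(\gamma).\langle\beta,\delta\rangle-\pi_\#(\delta).\langle\beta,\gamma\rangle+\langle[\delta,\beta]_\pi,\gamma\rangle+\langle[\delta,\gamma]_\pi,\beta\rangle+\langle[\beta,\gamma]_\pi,\delta\rangle ,$$ extended to $\pi$ by $(\mathcal D_\beta\pi)(\gamma,\delta)=\pi_\#(\beta).\pi(\gamma,\delta)-\pi(\mathcal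 D_\beta\gamma,\delta)-\pi(\gamma,\mathcal D_\beta\delta)$. Then the following assertions are equivalent: 1. $\pi$ is a Killing–Poisson tensor, that is: the bracket $\{\cdot,\cdot\}$ on $C^\infty(M)$ satisfies the Jacobi identity; the divergence of $\pi$ with respect to the Levi-Civita connection vanishes; and for every open set $U\subset M$ and every $f\in C^\infty(U)$ with $\pi_\#(df)=0$ on $U$ one has $L_{\nabla f}\pi=0$ on $U$, where $\nabla f=\#(df)$. 2. $\mathcal D\pi=0$. 3. The 1-form $\alpha=i_\pi\mu$ satisfies $$d\alpha=0\quad\text{and}\quad d\langle\alpha,\alpha\rangle+\delta(\alpha)\,\alpha=0,$$ where $\delta(\alpha)=-\operatorname{div}(\#(\alpha))$. -/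

import Mathlib

open scoped Manifold ContDiff

noncomputable section

namespace KillingPoisson

/-- Coordinate space `ℝⁿ`. -/
abbrev Coord (n : ℕ) : Type := EuclideanSpace ℝ (Fin n)

/-! ### Tensor calculus in coordinates

On an open subset of `ℝⁿ` a vector field `X = ∑ Xⁱ ∂ᵢ` and a 1-form `β = ∑ βᵢ dxⁱ` are given by
their component functions, and so are a metric `g = (gᵢⱼ)` and a bivector field `π = (πⁱʲ)`,
`πⁱʲ = π(dxⁱ, dxʲ)`. -/

section Coordinates

variable {n : ℕ}

/-- The partial derivative `∂ᵢ f` at `y`. -/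
def pderiv (i : Fin n) (f : Coord n → ℝ) (y : Coord n) : ℝ :=
  fderiv ℝ f y (EuclideanSpace.single i 1)

/-- The differential `df` of a function. -/
def dFun (f : Coord n → ℝ) : Coord n → Fin n → ℝ :=
  fun y i => pderiv i f y

/-- The exterior derivative of a 1-form: `(dβ)ᵢⱼ = ∂ᵢ βⱼ - ∂ⱼ βᵢ`. -/
def extDerivForm (β : Coord n → Fin n → ℝ) : Coord n → Matrix (Fin n) (Fin n) ℝ :=
  fun y => Matrix.of fun i j => pderiv i (fun z => β z j) y - pderiv j (fun z => β z i) y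

/-- The derivative `X.f = df(X)` of a function along a vector field. -/
def derivAlong (X : Coord n → Fin n → ℝ) (f : Coord n → ℝ) : Coord n → ℝ :=
  fun y => ∑ i, X y i * pderiv i f y

/-- The Lie derivative of a 1-form: `(L_X β)ⱼ = ∑ᵢ (Xⁱ ∂ᵢ βⱼ + βᵢ ∂ⱼ Xⁱ)`. -/
def lieForm (X β : Coord n → Fin n → ℝ) : Coord n → Fin n → ℝ :=
  fun y j => ∑ i, (X y i * pderiv i (fun z => β z j) y + β y i * pderiv j (fun z => X z i) y)

/-- The Lie derivative of a bivector field: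
`(L_X π)ʲᵏ = ∑ᵢ (Xⁱ ∂ᵢ πʲᵏ - πⁱᵏ ∂ᵢ Xʲ - πʲⁱ ∂ᵢ Xᵏ)`. -/
def lieBivector (X : Coord n → Fin n → ℝ) (π : Coord n → Matrix (Fin n) (Fin n) ℝ) :
    Coord n → Matrix (Fin n) (Fin n) ℝ :=
  fun y => Matrix.of fun j k => ∑ i, (X y i * pderiv i (fun z => π z j k) y
    - π y i k * pderiv i (fun z => X z j) y - π y j i * pderiv i (fun z => X z k) y)

/-! #### Riemannian metric -/

/-- The metric on 1-forms: `⟨β, γ⟩ = ∑ gⁱʲ βᵢ γⱼ`, where `(gⁱʲ)` is the inverse matrix of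
`(gᵢⱼ)`. -/
def cometric (g : Coord n → Matrix (Fin n) (Fin n) ℝ) (β γ : Coord n → Fin n → ℝ) : Coord n → ℝ :=
  fun y => ∑ i, ∑ j, (g y)⁻¹ i j * β y i * γ y j

/-- The vector field `#β` that is metrically dual to a 1-form: `(#β)ⁱ = ∑ⱼ gⁱʲ βⱼ`. -/
def sharp (g : Coord n → Matrix (Fin n) (Fin n) ℝ) (β : Coord n → Fin n → ℝ) :
    Coord n → Fin n → ℝ :=
  fun y i => ∑ j, (g y)⁻¹ i j * β y j

/-- The gradient `∇f = #(df)`. -/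
def gradient (g : Coord n → Matrix (Fin n) (Fin n) ℝ) (f : Coord n → ℝ) : Coord n → Fin n → ℝ :=
  sharp g (dFun f)

/-- The Christoffel symbols of the Levi-Civita connection, `∇_{∂ᵢ} ∂ⱼ = ∑ₖ Γᵏᵢⱼ ∂ₖ`:
`Γᵏᵢⱼ = ½ ∑ₗ gᵏˡ (∂ᵢ gⱼₗ + ∂ⱼ gᵢₗ - ∂ₗ gᵢⱼ)`. -/
def christoffel (g : Coord n → Matrix (Fin n) (Fin n) ℝ) (k i j : Fin n) : Coord n → ℝ :=
  fun y => (1 / 2) * ∑ l, (g y)⁻¹ k l * (pderiv i (fun z => g z j l) y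
    + pderiv j (fun z => g z i l) y - pderiv l (fun z => g z i j) y)

/-- The divergence of a vector field for the Levi-Civita connection:
`div X = ∑ᵢ (∇_{∂ᵢ} X)ⁱ`. -/
def divVector (g : Coord n → Matrix (Fin n) (Fin n) ℝ) (X : Coord n → Fin n → ℝ) : Coord n → ℝ :=
  fun y => ∑ i, (pderiv i (fun z => X z i) y + ∑ j, christoffel g i i j y * X y j)

/-- The Levi-Civita covariant derivative of a bivector field:
`(∇_{∂ᵢ} π)ʲᵏ = ∂ᵢ πʲᵏ + ∑ₗ (Γʲᵢₗ πˡᵏ + Γᵏᵢₗ πʲˡ)`. -/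
def nablaBivector (g π : Coord n → Matrix (Fin n) (Fin n) ℝ) (i j k : Fin n) : Coord n → ℝ :=
  fun y => pderiv i (fun z => π z j k) y
    + ∑ l, (christoffel g j i l y * π y l k + christoffel g k i l y * π y j l)

/-- The divergence of a bivector field for the Levi-Civita connection, the contraction of `∇π`:
`(div π)ᵏ = ∑ᵢ (∇_{∂ᵢ} π)ⁱᵏ`. -/
def divBivector (g π : Coord n → Matrix (Fin n) (Fin n) ℝ) : Coord n → Fin n → ℝ :=
  fun y k => ∑ i, nablaBivector g π i i k y

/-! #### The metric contravariant connection -/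

/-- The function `π(β, γ) = ∑ πⁱʲ βᵢ γⱼ`. -/
def pairing (π : Coord n → Matrix (Fin n) (Fin n) ℝ) (β γ : Coord n → Fin n → ℝ) : Coord n → ℝ :=
  fun y => ∑ i, ∑ j, π y i j * β y i * γ y j

/-- The anchor map: the vector field `π_#(β)` with `γ(π_#(β)) = π(β, γ)`. -/
def anchor (π : Coord n → Matrix (Fin n) (Fin n) ℝ) (β : Coord n → Fin n → ℝ) :
    Coord n → Fin n → ℝ :=
  fun y j => ∑ i, π y i j * β y i

/-- The Koszul bracket `[β, γ]_π = L_{π_#(β)} γ - L_{π_#(γ)} β - d(π(β, γ))`. -/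
def koszulBracket (π : Coord n → Matrix (Fin n) (Fin n) ℝ) (β γ : Coord n → Fin n → ℝ) :
    Coord n → Fin n → ℝ :=
  lieForm (anchor π β) γ - lieForm (anchor π γ) β - dFun (pairing π β γ)

/-- The right-hand side of the Koszul formula for `2 ⟨𝒟_β γ, δ⟩`. -/
def koszulRHS (g π : Coord n → Matrix (Fin n) (Fin n) ℝ) (β γ δ : Coord n → Fin n → ℝ) :
    Coord n → ℝ :=
  derivAlong (anchor π β) (cometric g γ δ) + derivAlong (anchor π γ) (cometric g β δ)
    - derivAlong (anchor π δ) (cometric g β γ)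
    + cometric g (koszulBracket π δ β) γ + cometric g (koszulBracket π δ γ) β
    + cometric g (koszulBracket π β γ) δ

/-- The constant 1-form `dxˡ`. -/
def dx (l : Fin n) : Coord n → Fin n → ℝ :=
  fun _ => Pi.single l 1

/-- The metric contravariant connection `𝒟` of `(π, ⟨ , ⟩)`: `𝒟_β γ` is the 1-form determined by
the Koszul formula `2 ⟨𝒟_β γ, δ⟩ = koszulRHS g π β γ δ`. Its components are
`(𝒟_β γ)ₖ = ∑ₗ gₖₗ ⟨𝒟_β γ, dxˡ⟩`. -/
def contravariantD (g π : Coord n → Matrix (Fin n) (Fin n) ℝ) (β γ : Coord n → Fin n → ℝ) :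
    Coord n → Fin n → ℝ :=
  fun y k => ∑ l, g y k l * ((1 / 2) * koszulRHS g π β γ (dx l) y)

/-- `(𝒟_β π)(γ, δ) = π_#(β).π(γ, δ) - π(𝒟_β γ, δ) - π(γ, 𝒟_β δ)`. -/
def contravariantDπ (g π : Coord n → Matrix (Fin n) (Fin n) ℝ) (β γ δ : Coord n → Fin n → ℝ) :
    Coord n → ℝ :=
  derivAlong (anchor π β) (pairing π γ δ)
    - pairing π (contravariantD g π β γ) δ - pairing π γ (contravariantD g π β δ)

/-- The Levi-Civita symbol `εᵢⱼₖ`: the determinant of the matrix with rows `eᵢ, eⱼ, eₖ`. -/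
def leviCivita (i j k : Fin 3) : ℝ :=
  (Matrix.of fun r c : Fin 3 => if ![i, j, k] r = c then (1 : ℝ) else 0).det

end Coordinates

/-! ### Tensor fields on a manifold -/

section Manifold

variable {n : ℕ} {M : Type*} [TopologicalSpace M] [ChartedSpace (Coord n) M]
  [IsManifold (𝓡 n) ∞ M]

/-- The coordinate vector `∂ᵢ` of the chart `e`, at the point with coordinates `y`. -/
def coordVec (e : OpenPartialHomeomorph M (Coord n)) (y : Coord n) (i : Fin n) :
    TangentSpace (𝓡 n) (e.symm y) :=
  mfderiv (𝓡 n) (𝓡 n) e.symm y (EuclideanSpace.single i 1 : Coord n)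

/-- The coordinate covector `dxⁱ` of the chart `e`, at the point with coordinates `y`. -/
def coordCovec (e : OpenPartialHomeomorph M (Coord n)) (y : Coord n) (i : Fin n) :
    TangentSpace (𝓡 n) (e.symm y) →L[ℝ] ℝ :=
  mvfderiv (𝓡 n) (fun p : M => e p i) (e.symm y)

/-- The components `gᵢⱼ = g(∂ᵢ, ∂ⱼ)` of a Riemannian metric in the chart `e`. -/
def metricComp
    (g : Bundle.ContMDiffRiemannianMetric (𝓡 n) ∞ (Coord n)
      (fun x : M => TangentSpace (𝓡 n) x))
    (e : OpenPartialHomeomorph M (Coord n)) : Coord n → Matrix (Fin n) (Fin n) ℝ :=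
  fun y => Matrix.of fun i j => g.inner (e.symm y) (coordVec e y i) (coordVec e y j)

variable (n M) in
/-- A smooth bivector field on `M`: an alternating bilinear form on each cotangent space, with
smooth components `π(dxⁱ, dxʲ)` in all charts. -/
structure BivectorField where
  /-- The bilinear form on the cotangent space at `x`. -/
  toFun : ∀ x : M,
    (TangentSpace (𝓡 n) x →L[ℝ] ℝ) →ₗ[ℝ] (TangentSpace (𝓡 n) x →L[ℝ] ℝ) →ₗ[ℝ] ℝ
  alternating : ∀ (x : M) (β : TangentSpace (𝓡 n) x →L[ℝ] ℝ), toFun x β β = 0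
  smooth : ∀ e ∈ atlas (Coord n) M, ∀ i j : Fin n,
    ContDiffOn ℝ ∞ (fun y => toFun (e.symm y) (coordCovec e y i) (coordCovec e y j)) e.target

/-- The components `πⁱʲ = π(dxⁱ, dxʲ)` of a bivector field in the chart `e`. -/
def BivectorField.comp (π : BivectorField n M) (e : OpenPartialHomeomorph M (Coord n)) :
    Coord n → Matrix (Fin n) (Fin n) ℝ :=
  fun y => Matrix.of fun i j => π.toFun (e.symm y) (coordCovec e y i) (coordCovec e y j)

/-- The bracket `{f, h} = π(df, dh)` of two functions. -/
def BivectorField.bracket (π : BivectorField n M) (f h : M → ℝ) : M → ℝ :=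
  fun x => π.toFun x (mvfderiv (𝓡 n) f x) (mvfderiv (𝓡 n) h x)

/-- `π` is a Poisson tensor: the bracket of smooth functions satisfies the Jacobi identity. -/
def BivectorField.IsPoisson (π : BivectorField n M) : Prop :=
  ∀ f h k : M → ℝ, ContMDiff (𝓡 n) 𝓘(ℝ, ℝ) ∞ f → ContMDiff (𝓡 n) 𝓘(ℝ, ℝ) ∞ h →
    ContMDiff (𝓡 n) 𝓘(ℝ, ℝ) ∞ k → ∀ x : M,
      π.bracket f (π.bracket h k) x + π.bracket h (π.bracket k f) x
        + π.bracket k (π.bracket f h) x = 0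

/-- `f` is a Casimir function of `π` on `U`: `π(df, ·) = 0`, that is, the Hamiltonian vector field
of `f` vanishes on `U`. -/
def BivectorField.IsCasimirOn (π : BivectorField n M) (f : M → ℝ) (U : Set M) : Prop :=
  ∀ x ∈ U, ∀ β : TangentSpace (𝓡 n) x →L[ℝ] ℝ, π.toFun x (mvfderiv (𝓡 n) f x) β = 0

/-- `π` is a Killing-Poisson tensor on `(M, g)`: it is a Poisson tensor whose divergence for the
Levi-Civita connection vanishes, and `L_{∇f} π = 0` on `U` for all open sets `U` and all smooth
Casimir functions `f` on `U`. -/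
structure IsKillingPoisson
    (g : Bundle.ContMDiffRiemannianMetric (𝓡 n) ∞ (Coord n)
      (fun x : M => TangentSpace (𝓡 n) x))
    (π : BivectorField n M) : Prop where
  isPoisson : π.IsPoisson
  div_eq_zero : ∀ e ∈ atlas (Coord n) M, ∀ y ∈ e.target,
    divBivector (metricComp g e) (π.comp e) y = 0
  lie_gradient_eq_zero : ∀ (U : Set M) (f : M → ℝ), IsOpen U →
    ContMDiffOn (𝓡 n) 𝓘(ℝ, ℝ) ∞ f U → π.IsCasimirOn f U →
      ∀ e ∈ atlas (Coord n) M, ∀ y ∈ e.target, e.symm y ∈ U →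
        lieBivector (gradient (metricComp g e) (fun z => f (e.symm z))) (π.comp e) y = 0

/-- `𝒟π = 0`: the bivector field `π` is parallel for the metric contravariant connection. -/
def IsContravariantParallel
    (g : Bundle.ContMDiffRiemannianMetric (𝓡 n) ∞ (Coord n)
      (fun x : M => TangentSpace (𝓡 n) x))
    (π : BivectorField n M) : Prop :=
  ∀ e ∈ atlas (Coord n) M, ∀ β γ δ : Coord n → Fin n → ℝ,
    ContDiffOn ℝ ∞ β e.target → ContDiffOn ℝ ∞ γ e.target → ContDiffOn ℝ ∞ δ e.target →
      ∀ y ∈ e.target, contravariantDπ (metricComp g e) (π.comp e) β γ δ y = 0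

variable (n M) in
/-- An orientation of `M`: an orientation of each tangent space, such that in each chart the sign of
the coordinate frame `(∂₁, …, ∂ₙ)` is locally constant. -/
structure ManifoldOrientation where
  /-- The orientation of the tangent space at `x`. -/
  orient : ∀ x : M, Orientation ℝ (TangentSpace (𝓡 n) x) (Fin n)
  continuous_sign : ∀ e ∈ atlas (Coord n) M,
    ContinuousOn (fun y => SignType.sign ((orient (e.symm y)).someVector (coordVec e y))) e.target

/-- The sign `±1` of the coordinate frame `(∂₁, …, ∂ₙ)` of the chart `e` for the orientation. -/
def ManifoldOrientation.sign (o : ManifoldOrientation n M)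
    (e : OpenPartialHomeomorph M (Coord n)) (y : Coord n) : ℝ :=
  (SignType.sign ((o.orient (e.symm y)).someVector (coordVec e y)) : ℝ)

end Manifold

section Dimension3

variable {M : Type*} [TopologicalSpace M] [ChartedSpace (Coord 3) M] [IsManifold (𝓡 3) ∞ M]

/-- The components in the chart `e` of the Riemannian volume form `μ` of an oriented Riemannian
3-manifold: `μᵢⱼₖ = μ(∂ᵢ, ∂ⱼ, ∂ₖ) = ± √(det g) εᵢⱼₖ`, with `+` if the coordinate frame is
positively oriented and `-` otherwise. -/
def volumeComp (o : ManifoldOrientation 3 M)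
    (g : Bundle.ContMDiffRiemannianMetric (𝓡 3) ∞ (Coord 3)
      (fun x : M => TangentSpace (𝓡 3) x))
    (e : OpenPartialHomeomorph M (Coord 3)) (i j k : Fin 3) : Coord 3 → ℝ :=
  fun y => o.sign e y * √(metricComp g e y).det * leviCivita i j k

/-- The components in the chart `e` of the 1-form `α = i_π μ`, where `i_{X ∧ Y} μ = μ(X, Y, ·)`:
`αₖ = ½ ∑ᵢⱼ πⁱʲ μᵢⱼₖ`. -/
def dualForm (o : ManifoldOrientation 3 M)
    (g : Bundle.ContMDiffRiemannianMetric (𝓡 3) ∞ (Coord 3)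
      (fun x : M => TangentSpace (𝓡 3) x))
    (π : BivectorField 3 M) (e : OpenPartialHomeomorph M (Coord 3)) : Coord 3 → Fin 3 → ℝ :=
  fun y k => (1 / 2) * ∑ i, ∑ j, π.comp e y i j * volumeComp o g e i j k y

/-- The function `δ(α) = -div(#α)`. -/
def codifferential (g : Coord 3 → Matrix (Fin 3) (Fin 3) ℝ) (α : Coord 3 → Fin 3 → ℝ) :
    Coord 3 → ℝ :=
  fun y => -divVector g (sharp g α) y

end Dimension3

end KillingPoisson

end

/-! In dimension 3 a chart identifies bivectors with 1-forms. Up to sign let `w` be `(det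
g)^(-1/2)`; then `π = w ∗ α`, meaning `πⁱʲ = w ∑ εᵢⱼₖ αₖ`, and `π_#(β)` is `w` times the cross
product `α × β`. All three assertions become statements about `α`, checked chart by chart on an
`IsDualPair`.

Three identities link 1 and 3: `div π = w ∗ dα`; `L_X π = w ∗ (L_X α - (div X) α)`; and the
Jacobiator of `π` is, up to sign, `w² α·curl α` times `det(df, dh, dk)`. So `div π = 0` means `dα =
0`, which already implies Jacobi. For closed `α`, Cartan's formula gives `L_{#α} α = d⟨α, α⟩`, so
the second equation of 3 says `L_{#α} π = 0`. A local potential of a closed `α` is a Casimir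
function with gradient `#α`, which gives 1 ⇒ 3. Conversely a Casimir function has `df = q α` where
`α ≠ 0`, with `dq ∧ α = 0`, and then `L_{∇f} π = q L_{#α} π = 0`. On the interior of the zero set of
`α` the tensor `π` vanishes, and continuity covers the remaining points.

For 2 ⇔ 3, `𝒟` is metric and hence preserves the volume, so `𝒟_β π = w ∗ 𝒟_β α`
(`contravariantDπ_apply`). The Koszul formula gives (`two_mul_bilin_covForm`) `2⟨𝒟_β α, δ⟩ =
-(L_{#α} π)(β, δ) + dα(π_# β, #δ) + dα(π_# δ, #β)`. This is a splitting into an antisymmetric and a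
symmetric part in `(β, δ)`. Vanishing of the symmetric part forces `α = 0` or `dα = 0` at each point
(`eq_zero_or_curl_eq_zero`). Since `α` vanishes on the open set where `dα ≠ 0`, that set is empty.
What remains is `L_{#α} π = 0`. -/

noncomputable section

namespace KillingPoisson

section PointwiseAlgebra

/-! ### Pointwise algebra -/

/-- The bilinear form with matrix `m`. -/
def bilin {n : ℕ} (m : Matrix (Fin n) (Fin n) ℝ) (u v : Fin n → ℝ) : ℝ :=
  ∑ i, ∑ j, m i j * u i * v j

/-- The anchor map of the bivector with matrix `p`. -/
def anchorAt {n : ℕ} (p : Matrix (Fin n) (Fin n) ℝ) (u : Fin n → ℝ) : Fin n → ℝ :=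
  fun j => ∑ i, p i j * u i

/-- The tensorial part of the Koszul formula, in terms of the first jets of the cometric `H` and of
the bivector `p`. -/
def koszulTensor {n : ℕ} (H : Matrix (Fin n) (Fin n) ℝ) (dH : Fin n → Matrix (Fin n) (Fin n) ℝ)
    (p : Matrix (Fin n) (Fin n) ℝ) (dp : Fin n → Matrix (Fin n) (Fin n) ℝ)
    (β γ δ : Fin n → ℝ) : ℝ :=
  ∑ j, anchorAt p β j * bilin (dH j) γ δ + ∑ j, anchorAt p γ j * bilin (dH j) β δ
    - ∑ j, anchorAt p δ j * bilin (dH j) β γ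
    + bilin H (fun k => bilin (dp k) δ β) γ + bilin H (fun k => bilin (dp k) δ γ) β
    + bilin H (fun k => bilin (dp k) β γ) δ

/-- The tensorial part of the metric contravariant connection. -/
def contraSymbol {n : ℕ} (g H : Matrix (Fin n) (Fin n) ℝ) (dH : Fin n → Matrix (Fin n) (Fin n) ℝ)
    (p : Matrix (Fin n) (Fin n) ℝ) (dp : Fin n → Matrix (Fin n) (Fin n) ℝ)
    (β γ : Fin n → ℝ) : Fin n → ℝ :=
  fun k => ∑ l, g k l * ((1 / 2) * koszulTensor H dH p dp β γ (Pi.single l 1))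

/-- The antisymmetric matrix `v ↦ (i, j) ↦ ∑ₖ εᵢⱼₖ vₖ`. -/
def crossMatrix (v : Fin 3 → ℝ) : Matrix (Fin 3) (Fin 3) ℝ :=
  !![0, v 2, -v 1; -v 2, 0, v 0; v 1, -v 0, 0]

theorem crossMatrix_eq_zero_iff {v : Fin 3 → ℝ} : crossMatrix v = 0 ↔ v = 0 := by
  constructor
  · intro h
    ext k
    have h1 := congrFun (congrFun h 0) 1
    have h2 := congrFun (congrFun h 2) 0
    have h3 := congrFun (congrFun h 1) 2
    fin_cases k <;> simp_all [crossMatrix]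
  · rintro rfl
    ext i j
    fin_cases i <;> fin_cases j <;> simp [crossMatrix]

theorem bilin_add_left {n : ℕ} (m : Matrix (Fin n) (Fin n) ℝ) (u u' v : Fin n → ℝ) :
    bilin m (u + u') v = bilin m u v + bilin m u' v := by
  simp only [bilin, Pi.add_apply, mul_add, add_mul, Finset.sum_add_distrib]

theorem bilin_add_right {n : ℕ} (m : Matrix (Fin n) (Fin n) ℝ) (u v v' : Fin n → ℝ) :
    bilin m u (v + v') = bilin m u v + bilin m u v' := by
  simp only [bilin, Pi.add_apply, mul_add, Finset.sum_add_distrib]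

variable {g H p : Matrix (Fin 3) (Fin 3) ℝ} {dH dp : Fin 3 → Matrix (Fin 3) (Fin 3) ℝ}

theorem koszulTensor_linear_mid (β γ δ : Fin 3 → ℝ) :
    koszulTensor H dH p dp β γ δ =
      ∑ m, γ m * koszulTensor H dH p dp β (Pi.single m 1) δ := by
  simp only [koszulTensor, bilin, anchorAt, Fin.sum_univ_three]
  simp
  ring

theorem koszulTensor_linear_right (β γ δ : Fin 3 → ℝ) :
    koszulTensor H dH p dp β γ δ =
      ∑ m, δ m * koszulTensor H dH p dp β γ (Pi.single m 1) := by
  simp only [koszulTensor, bilin, anchorAt, Fin.sum_univ_three]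
  simp
  ring

theorem contraSymbol_linear (β γ : Fin 3 → ℝ) (k : Fin 3) :
    contraSymbol g H dH p dp β γ k =
      ∑ m, γ m * contraSymbol g H dH p dp β (Pi.single m 1) k := by
  simp only [contraSymbol]
  simp only [koszulTensor_linear_mid β γ, Finset.mul_sum]
  rw [Finset.sum_comm]
  refine Finset.sum_congr rfl fun m _ => Finset.sum_congr rfl fun l _ => ?_
  ring

/-- Metric compatibility of `𝒟`: the bracket terms and the derivatives along `γ` and `δ` cancel in
pairs. -/
theorem koszulTensor_add_swap (hH : ∀ i j, H i j = H j i) (hdH : ∀ k i j, dH k i j = dH k j i)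
    (hdp : ∀ k i j, dp k i j = -dp k j i) (β γ δ : Fin 3 → ℝ) :
    koszulTensor H dH p dp β γ δ + koszulTensor H dH p dp β δ γ =
      2 * ∑ j, anchorAt p β j * bilin (dH j) γ δ := by
  have hd0 : ∀ k u v, bilin (dH k) u v = bilin (dH k) v u := by
    intro k u v
    simp only [bilin]
    rw [Finset.sum_comm]
    refine Finset.sum_congr rfl fun _ _ => Finset.sum_congr rfl fun _ _ => ?_
    rw [hdH]; ring
  have hp0 : ∀ k u v, bilin (dp k) u v = -bilin (dp k) v u := by
    intro k u v
    simp only [bilin]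
    rw [Finset.sum_comm, ← Finset.sum_neg_distrib]
    refine Finset.sum_congr rfl fun _ _ => ?_
    rw [← Finset.sum_neg_distrib]
    refine Finset.sum_congr rfl fun _ _ => ?_
    rw [hdp]; ring
  have hH0 : ∀ u v, bilin H u v = bilin H v u := by
    intro u v
    simp only [bilin]
    rw [Finset.sum_comm]
    refine Finset.sum_congr rfl fun _ _ => Finset.sum_congr rfl fun _ _ => ?_
    rw [hH]; ring
  have hneg : ∀ u v, bilin H (fun k => -u k) v = -bilin H u v := by
    intro u v
    simp [bilin, Finset.sum_neg_distrib]
  have e1 : bilin H (fun k => bilin (dp k) δ γ) β = -bilin H (fun k => bilin (dp k) γ δ) β := by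
    rw [← hneg]; simp only [← hp0]
  have e2 : bilin H (fun k => bilin (dp k) δ β) γ = -bilin H (fun k => bilin (dp k) β δ) γ := by
    rw [← hneg]; simp only [← hp0]
  have e3 : bilin H (fun k => bilin (dp k) γ β) δ = -bilin H (fun k => bilin (dp k) β γ) δ := by
    rw [← hneg]; simp only [← hp0]
  simp only [koszulTensor, e1, e2, e3, hd0 _ δ γ]
  ring

/-- A metric connection has a trace determined by the metric alone. With `q = d log w` this says
that `𝒟` preserves the volume element. -/
theorem contraSymbol_trace (hg : ∀ i j, g i j = g j i) (hH : ∀ i j, H i j = H j i)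
    (hdH : ∀ k i j, dH k i j = dH k j i) (hdp : ∀ k i j, dp k i j = -dp k j i)
    {q : Fin 3 → ℝ} (hq : ∀ j, (1 / 2) * ∑ k, ∑ l, g k l * dH j k l = q j) (β : Fin 3 → ℝ) :
    ∑ k, contraSymbol g H dH p dp β (Pi.single k 1) k = ∑ j, anchorAt p β j * q j := by
  have h1 : ∀ k l, bilin (dH k) (Pi.single l 1) = fun v => ∑ m, dH k l m * v m := by
    intro k l
    funext v
    simp [bilin, Pi.single_apply]
  have h : ∀ k l, koszulTensor H dH p dp β (Pi.single k 1) (Pi.single l 1)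
      + koszulTensor H dH p dp β (Pi.single l 1) (Pi.single k 1)
      = 2 * ∑ j, anchorAt p β j * dH j k l := by
    intro k l
    rw [koszulTensor_add_swap hH hdH hdp]
    simp [h1, Pi.single_apply]
  simp only [contraSymbol]
  -- Since `g` is symmetric, only the symmetrization in `(k, l)` contributes; its `1/2` turns the
  -- factor `1/2` into `1/4`.
  have : ∑ k, ∑ l, g k l * (1 / 2 * koszulTensor H dH p dp β (Pi.single k 1) (Pi.single l 1))
      = (1 / 4) * ∑ k, ∑ l, g k l * (koszulTensor H dH p dp β (Pi.single k 1) (Pi.single l 1)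
      + koszulTensor H dH p dp β (Pi.single l 1) (Pi.single k 1)) := by
    simp only [Fin.sum_univ_three, hg 1 0, hg 2 0, hg 2 1]
    ring
  rw [this]
  simp only [h, ← hq, Fin.sum_univ_three]
  ring

/-- For `p = w ∗ α`, the derivative of the bivector along `β` is the contraction of the volume
element with the derivative of `α`. -/
theorem parallel_defect_eq {w : ℝ} {dw α : Fin 3 → ℝ} {dα : Fin 3 → Fin 3 → ℝ}
    (hp : p = crossMatrix (w • α)) (hdp : ∀ k, dp k = crossMatrix (dw k • α + w • dα k))
    (β γ δ : Fin 3 → ℝ)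
    (htr : w * ∑ k, contraSymbol g H dH p dp β (Pi.single k 1) k = ∑ j, anchorAt p β j * dw j) :
    ∑ j, anchorAt p β j * bilin (dp j) γ δ - bilin p (contraSymbol g H dH p dp β γ) δ
        - bilin p γ (contraSymbol g H dH p dp β δ)
      = w * bilin (crossMatrix (fun k => ∑ j, anchorAt p β j * dα j k
          + contraSymbol g H dH p dp β α k)) γ δ := by
  generalize hA : contraSymbol g H dH p dp β = A at *
  have hlin : ∀ u k, A u k = ∑ m, u m * A (Pi.single m 1) k := by
    intro u k
    rw [← hA]; exact contraSymbol_linear _ _ _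
  generalize hX : anchorAt p β = X at *
  simp only [hdp]
  simp only [hp, bilin, hlin γ, hlin δ, hlin α]
  generalize hB : (fun m => A (Pi.single m 1)) = B at *
  have hB' : ∀ m, A (Pi.single m 1) = B m := fun m => congrFun hB m
  simp only [hB'] at *
  simp only [crossMatrix, Fin.sum_univ_three, Pi.smul_apply, Pi.add_apply, smul_eq_mul,
    Matrix.of_apply, Matrix.cons_val', Matrix.cons_val_zero, Matrix.cons_val_one,
    Matrix.cons_val, Matrix.cons_val_fin_one] at *
  -- An endomorphism acts on the volume element through its trace, so the defect is the trace
  -- identity times `-α·(γ × δ)`.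
  linear_combination (-(γ 0 * δ 1 - γ 1 * δ 0) * α 2 - (γ 1 * δ 2 - γ 2 * δ 1) * α 0
    - (γ 2 * δ 0 - γ 0 * δ 2) * α 1) * htr

/-- Jet form of the splitting of `2⟨𝒟_β α, δ⟩`. As `p_#(α) = 0`, Cartan's formula reduces `[β, α]_π`
to the contraction of `dα` with `π_# β`, and likewise for `δ`; this yields the two `dα` terms. The
remaining Koszul terms add up to `-(L_{#α} π)(β, δ)`. -/
theorem koszulTensor_dual_form {w : ℝ} {dw α : Fin 3 → ℝ} {dα : Fin 3 → Fin 3 → ℝ}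
    (hH : ∀ i j, H i j = H j i) (hdH : ∀ k i j, dH k i j = dH k j i)
    (hp : p = crossMatrix (w • α)) (hdp : ∀ k, dp k = crossMatrix (dw k • α + w • dα k))
    (β δ : Fin 3 → ℝ) :
    2 * bilin H (fun k => ∑ j, anchorAt p β j * dα j k) δ + koszulTensor H dH p dp β α δ
      = -∑ j, ∑ k, (∑ i, ((∑ l, H i l * α l) * dp i j k
            - p i k * (∑ l, (dH i j l * α l + H j l * dα i l))
            - p j i * (∑ l, (dH i k l * α l + H k l * dα i l)))) * β j * δ k
        + ∑ i, ∑ j, (dα i j - dα j i) * anchorAt p β i * (∑ l, H j l * δ l)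
        + ∑ i, ∑ j, (dα i j - dα j i) * anchorAt p δ i * (∑ l, H j l * β l) := by
  have h1 := hH 1 0
  have h2 := hH 2 0
  have h3 := hH 2 1
  have k1 := fun k => hdH k 1 0
  have k2 := fun k => hdH k 2 0
  have k3 := fun k => hdH k 2 1
  simp only [koszulTensor, bilin, hdp]
  simp only [hp, anchorAt, crossMatrix, Fin.sum_univ_three, Pi.smul_apply, Pi.add_apply,
    smul_eq_mul, Matrix.of_apply, Matrix.cons_val', Matrix.cons_val_zero, Matrix.cons_val_one,
    Matrix.cons_val, Matrix.cons_val_fin_one, h1, h2, h3, k1, k2, k3]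
  ring

/-- If the symmetric part of `𝒟α` vanishes, then `α = 0` or `dα = 0`. -/
theorem eq_zero_or_curl_eq_zero {w : ℝ} (hw : w ≠ 0) {α : Fin 3 → ℝ}
    {c : Fin 3 → ℝ} (hH : H.PosDef) (hp : p = crossMatrix (w • α))
    (h : ∀ β δ : Fin 3 → ℝ,
      ∑ i, ∑ j, crossMatrix c i j * anchorAt p β i * (∑ l, H j l * δ l)
        + ∑ i, ∑ j, crossMatrix c i j * anchorAt p δ i * (∑ l, H j l * β l) = 0) :
    α = 0 ∨ c = 0 := by
  have hs : ∀ i j, H i j = H j i := fun i j => by simpa using hH.isHermitian.apply j i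
  have h1 := hs 1 0
  have h2 := hs 2 0
  have h3 := hs 2 1
  -- The double cross product formula expands `c·((α × β) × #δ)`; the factor `w` is cancelled.
  have hS : ∀ β δ : Fin 3 → ℝ, bilin H α δ * (∑ k, c k * β k) + bilin H α β * (∑ k, c k * δ k)
      = 2 * (∑ k, c k * α k) * bilin H β δ := by
    intro β δ
    have := h β δ
    simp only [hp, bilin, anchorAt, crossMatrix, Fin.sum_univ_three, Pi.smul_apply, smul_eq_mul,
      Matrix.of_apply, Matrix.cons_val', Matrix.cons_val_zero, Matrix.cons_val_one,
      Matrix.cons_val, Matrix.cons_val_fin_one, h1, h2, h3] at this ⊢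
    apply mul_left_cancel₀ hw
    linear_combination this
  have hpos : ∀ u : Fin 3 → ℝ, u ≠ 0 → 0 < bilin H u u := by
    intro u hu
    have := hH.dotProduct_mulVec_pos hu
    simp only [dotProduct, Matrix.mulVec, Fin.sum_univ_three, bilin, star_trivial] at this ⊢
    linarith
  -- The left side of `hS` is a form of rank at most 2, so its determinant vanishes, while that of
  -- the right side is `(2q)³ det H`.
  have hq : ∑ k, c k * α k = 0 := by
    have hdet := hH.det_pos
    have hE : ∀ i j, (∑ l, H l j * α l) * c i + (∑ l, H l i * α l) * c j
        = 2 * (∑ k, c k * α k) * H i j := by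
      intro i j
      have := hS (Pi.single i 1) (Pi.single j 1)
      simpa [bilin, Pi.single_apply] using this
    generalize ∑ k, c k * α k = q at hE
    generalize hX : (fun j => ∑ l, H l j * α l) = X at hE
    have hX' : ∀ j, ∑ l, H l j * α l = X j := fun j => congrFun hX j
    simp only [hX'] at hE
    have key : (2 * q) ^ 3 * H.det = 0 := by
      have : (2 * q) ^ 3 * H.det = ((2 * q) • H).det := by simp
      rw [this, Matrix.det_fin_three]
      simp only [Matrix.smul_apply, smul_eq_mul, ← hE]
      ring
    simpa [hdet.ne'] using key
  by_contra! hne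
  have hα := hpos α hne.1
  apply hne.2
  ext k
  -- With `c·α = 0`, taking `δ = α` leaves `⟨α, α⟩ cₖ = 0`.
  have := hS (Pi.single k 1) α
  rw [hq] at this
  simpa [Pi.single_apply, hα.ne'] using this

end PointwiseAlgebra

/-! ### Calculus of partial derivatives -/

section Pderiv

variable {n : ℕ} {f h : Coord n → ℝ} {y : Coord n}

theorem pderiv_add (i : Fin n) (hf : DifferentiableAt ℝ f y) (hh : DifferentiableAt ℝ h y) :
    pderiv i (fun z => f z + h z) y = pderiv i f y + pderiv i h y := by
  simp [pderiv, fderiv_fun_add hf hh]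

theorem pderiv_sub (i : Fin n) (hf : DifferentiableAt ℝ f y) (hh : DifferentiableAt ℝ h y) :
    pderiv i (fun z => f z - h z) y = pderiv i f y - pderiv i h y := by
  simp [pderiv, fderiv_fun_sub hf hh]

theorem pderiv_neg (i : Fin n) : pderiv i (fun z => -f z) y = -pderiv i f y := by
  simp [pderiv, fderiv_fun_neg]

theorem pderiv_const (i : Fin n) (c : ℝ) : pderiv i (fun _ => c) y = 0 := by
  simp [pderiv]

theorem pderiv_mul (i : Fin n) (hf : DifferentiableAt ℝ f y) (hh : DifferentiableAt ℝ h y) :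
    pderiv i (fun z => f z * h z) y = pderiv i f y * h y + f y * pderiv i h y := by
  simp [pderiv, fderiv_fun_mul hf hh]
  ring

theorem pderiv_sum {ι : Type*} (s : Finset ι) {F : ι → Coord n → ℝ} (i : Fin n)
    (hF : ∀ a ∈ s, DifferentiableAt ℝ (F a) y) :
    pderiv i (fun z => ∑ a ∈ s, F a z) y = ∑ a ∈ s, pderiv i (F a) y := by
  simp [pderiv, fderiv_fun_sum hF]

theorem pderiv_congr (i : Fin n) (hfh : f =ᶠ[nhds y] h) : pderiv i f y = pderiv i h y := by
  simp [pderiv, hfh.fderiv_eq]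

theorem pderiv_congr_of_isOpen {T : Set (Coord n)} (hT : IsOpen T) (hy : y ∈ T)
    (hfh : ∀ z ∈ T, f z = h z) (i : Fin n) : pderiv i f y = pderiv i h y :=
  pderiv_congr i (Filter.eventuallyEq_of_mem (hT.mem_nhds hy) hfh)

theorem contDiffOn_pderiv {T : Set (Coord n)} (hT : IsOpen T) (hf : ContDiffOn ℝ ∞ f T)
    (i : Fin n) : ContDiffOn ℝ ∞ (pderiv i f) T :=
  (hf.fderiv_of_isOpen hT (by simp)).clm_apply contDiffOn_const

theorem pderiv_comm (hf : ContDiffAt ℝ ∞ f y) (i j : Fin n) :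
    pderiv i (pderiv j f) y = pderiv j (pderiv i f) y := by
  have hs : IsSymmSndFDerivAt ℝ f y := 
    (contDiffAt_infty.1 hf 2).isSymmSndFDerivAt (by simp)
  have hd : DifferentiableAt ℝ (fderiv ℝ f) y :=
    (hf.fderiv_right (m := ∞) (by simp)).differentiableAt (by simp)
  have key : ∀ a b : Fin n, pderiv a (pderiv b f) y
      = fderiv ℝ (fderiv ℝ f) y (EuclideanSpace.single a 1) (EuclideanSpace.single b 1) := by
    intro a b
    have : pderiv b f = fun z => fderiv ℝ f z (EuclideanSpace.single b 1) := rfl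
    rw [this, pderiv, fderiv_clm_apply hd (by fun_prop)]
    simp
  rw [key, key]
  exact hs _ _

theorem pderiv_bilin {m : Coord n → Matrix (Fin n) (Fin n) ℝ} {β γ : Coord n → Fin n → ℝ}
    (hm : ∀ i j, DifferentiableAt ℝ (fun z => m z i j) y)
    (hβ : ∀ i, DifferentiableAt ℝ (fun z => β z i) y)
    (hγ : ∀ i, DifferentiableAt ℝ (fun z => γ z i) y) (k : Fin n) :
    pderiv k (fun z => bilin (m z) (β z) (γ z)) y =
      bilin (Matrix.of fun i j => pderiv k (fun z => m z i j) y) (β y) (γ y)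
        + bilin (m y) (fun i => pderiv k (fun z => β z i) y) (γ y)
        + bilin (m y) (β y) (fun i => pderiv k (fun z => γ z i) y) := by
  simp only [bilin]
  rw [pderiv_sum _ _ (fun i _ => by fun_prop)]
  simp only [← Finset.sum_add_distrib]
  refine Finset.sum_congr rfl fun i _ => ?_
  rw [pderiv_sum _ _ (fun j _ => by fun_prop)]
  refine Finset.sum_congr rfl fun j _ => ?_
  rw [pderiv_mul _ (by fun_prop) (by fun_prop), pderiv_mul _ (by fun_prop) (by fun_prop)]
  simp only [Matrix.of_apply]
  ring

theorem pderiv_mulVec {m : Coord n → Matrix (Fin n) (Fin n) ℝ} {β : Coord n → Fin n → ℝ}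
    (hm : ∀ i j, DifferentiableAt ℝ (fun z => m z i j) y)
    (hβ : ∀ i, DifferentiableAt ℝ (fun z => β z i) y) (k i : Fin n) :
    pderiv k (fun z => ∑ j, m z i j * β z j) y =
      ∑ j, (pderiv k (fun z => m z i j) y * β y j + m y i j * pderiv k (fun z => β z j) y) := by
  rw [pderiv_sum _ _ (fun i _ => by fun_prop)]
  refine Finset.sum_congr rfl fun j _ => ?_
  rw [pderiv_mul _ (by fun_prop) (by fun_prop)]

theorem differentiableAt_of_contDiffOn {T : Set (Coord n)}
    (hf : ContDiffOn ℝ ∞ f T) (hT : IsOpen T) (hy : y ∈ T) :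
    DifferentiableAt ℝ f y :=
  (hf.contDiffAt (hT.mem_nhds hy)).differentiableAt (by simp)

theorem differentiableAt_mulVec {m : Coord n → Matrix (Fin n) (Fin n) ℝ} {β : Coord n → Fin n → ℝ}
    (hm : ∀ i j, DifferentiableAt ℝ (fun z => m z i j) y)
    (hβ : ∀ i, DifferentiableAt ℝ (fun z => β z i) y) (i : Fin n) :
    DifferentiableAt ℝ (fun z => ∑ j, m z i j * β z j) y := by
  fun_prop

theorem pderiv_sum_sum_mul {m m' : Coord n → Matrix (Fin n) (Fin n) ℝ}
    (hm : ∀ i j, DifferentiableAt ℝ (fun z => m z i j) y)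
    (hm' : ∀ i j, DifferentiableAt ℝ (fun z => m' z i j) y) (k : Fin n) :
    pderiv k (fun z => ∑ i, ∑ j, m z i j * m' z i j) y =
      ∑ i, ∑ j, (pderiv k (fun z => m z i j) y * m' y i j
        + m y i j * pderiv k (fun z => m' z i j) y) := by
  rw [pderiv_sum _ _ (fun i _ => by fun_prop)]
  refine Finset.sum_congr rfl fun i _ => ?_
  rw [pderiv_sum _ _ (fun j _ => by fun_prop)]
  exact Finset.sum_congr rfl fun j _ => pderiv_mul k (hm i j) (hm' i j)

theorem pderiv_det_expansion {F : Fin 3 → Fin 3 → Coord n → ℝ}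
    (hF : ∀ i j, DifferentiableAt ℝ (F i j) y) (k : Fin n) :
    pderiv k (fun z => F 0 0 z * F 1 1 z * F 2 2 z - F 0 0 z * F 1 2 z * F 2 1 z
        - F 0 1 z * F 1 0 z * F 2 2 z + F 0 1 z * F 1 2 z * F 2 0 z
        + F 0 2 z * F 1 0 z * F 2 1 z - F 0 2 z * F 1 1 z * F 2 0 z) y =
      pderiv k (F 0 0) y * (F 1 1 y * F 2 2 y - F 1 2 y * F 2 1 y)
        + pderiv k (F 0 1) y * (F 1 2 y * F 2 0 y - F 1 0 y * F 2 2 y)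
        + pderiv k (F 0 2) y * (F 1 0 y * F 2 1 y - F 1 1 y * F 2 0 y)
        + pderiv k (F 1 0) y * (F 0 2 y * F 2 1 y - F 0 1 y * F 2 2 y)
        + pderiv k (F 1 1) y * (F 0 0 y * F 2 2 y - F 0 2 y * F 2 0 y)
        + pderiv k (F 1 2) y * (F 0 1 y * F 2 0 y - F 0 0 y * F 2 1 y)
        + pderiv k (F 2 0) y * (F 0 1 y * F 1 2 y - F 0 2 y * F 1 1 y)
        + pderiv k (F 2 1) y * (F 0 2 y * F 1 0 y - F 0 0 y * F 1 2 y)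
        + pderiv k (F 2 2) y * (F 0 0 y * F 1 1 y - F 0 1 y * F 1 0 y) := by
  simp (disch := fun_prop) only [pderiv_add, pderiv_sub, pderiv_mul]
  ring

end Pderiv

/-! ### Local calculus on a Riemannian 3-manifold -/

/-- Local data in a chart domain `T`: a metric `g`, and a bivector field `π = w ∗ α`, where `w` is
the density of the volume element of the cometric, up to sign. -/
structure IsDualPair (g π : Coord 3 → Matrix (Fin 3) (Fin 3) ℝ) (α : Coord 3 → Fin 3 → ℝ)
    (w : Coord 3 → ℝ) (T : Set (Coord 3)) : Prop where
  isOpen : IsOpen T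
  contDiffOn_metric : ∀ i j, ContDiffOn ℝ ∞ (fun y => g y i j) T
  posDef : ∀ y ∈ T, (g y).PosDef
  contDiffOn_density : ContDiffOn ℝ ∞ w T
  contDiffOn_form : ∀ k, ContDiffOn ℝ ∞ (fun y => α y k) T
  sq_density : ∀ y ∈ T, w y ^ 2 * (g y).det = 1
  bivector_eq : ∀ y ∈ T, π y = crossMatrix (w y • α y)

theorem contDiffOn_inv_apply {g : Coord 3 → Matrix (Fin 3) (Fin 3) ℝ} {T : Set (Coord 3)}
    (hg : ∀ i j, ContDiffOn ℝ ∞ (fun y => g y i j) T) (hdet : ∀ y ∈ T, (g y).det ≠ 0)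
    (i j : Fin 3) : ContDiffOn ℝ ∞ (fun y => (g y)⁻¹ i j) T := by
  have h1 : ContDiffOn ℝ ∞ (fun y => (g y).det) T := by
    simp only [Matrix.det_fin_three]
    fun_prop
  have h2 : ContDiffOn ℝ ∞ (fun y => (g y).adjugate i j) T := by
    simp only [Matrix.adjugate_fin_three]
    fin_cases i <;> fin_cases j <;> simp <;> fun_prop
  simp only [Matrix.inv_def, Ring.inverse_eq_inv, Matrix.smul_apply, smul_eq_mul]
  exact (h1.inv hdet).mul h2

namespace IsDualPair

variable {g π : Coord 3 → Matrix (Fin 3) (Fin 3) ℝ} {α : Coord 3 → Fin 3 → ℝ}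
  {w : Coord 3 → ℝ} {T : Set (Coord 3)} {y : Coord 3}

theorem det_pos (D : IsDualPair g π α w T) (hy : y ∈ T) : 0 < (g y).det := (D.posDef y hy).det_pos

theorem density_ne_zero (D : IsDualPair g π α w T) (hy : y ∈ T) : w y ≠ 0 := by
  intro h
  have := D.sq_density y hy
  simp [h] at this

theorem metric_symm (D : IsDualPair g π α w T) (hy : y ∈ T) (i j : Fin 3) : g y i j = g y j i := by
  simpa using (D.posDef y hy).isHermitian.apply j i

theorem inv_symm (D : IsDualPair g π α w T) (hy : y ∈ T) (i j : Fin 3) :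
    (g y)⁻¹ i j = (g y)⁻¹ j i := by
  simpa using (D.posDef y hy).inv.isHermitian.apply j i

theorem contDiffOn_inv (D : IsDualPair g π α w T) (i j : Fin 3) :
    ContDiffOn ℝ ∞ (fun y => (g y)⁻¹ i j) T :=
  contDiffOn_inv_apply D.contDiffOn_metric (fun _ hy => (D.det_pos hy).ne') i j

theorem contDiffOn_bivector (D : IsDualPair g π α w T) (i j : Fin 3) :
    ContDiffOn ℝ ∞ (fun y => π y i j) T := by
  have hw := D.contDiffOn_density
  have hα := D.contDiffOn_form
  refine ContDiffOn.congr (f := fun y => crossMatrix (w y • α y) i j) ?_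
    (fun y hy => by rw [D.bivector_eq y hy])
  fin_cases i <;> fin_cases j <;> simp [crossMatrix] <;> fun_prop

theorem differentiableAt_metric (D : IsDualPair g π α w T) (hy : y ∈ T) (i j : Fin 3) :
    DifferentiableAt ℝ (fun z => g z i j) y :=
  differentiableAt_of_contDiffOn (D.contDiffOn_metric i j) D.isOpen hy

theorem differentiableAt_inv (D : IsDualPair g π α w T) (hy : y ∈ T) (i j : Fin 3) :
    DifferentiableAt ℝ (fun z => (g z)⁻¹ i j) y :=
  differentiableAt_of_contDiffOn (D.contDiffOn_inv i j) D.isOpen hy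

theorem differentiableAt_bivector (D : IsDualPair g π α w T) (hy : y ∈ T) (i j : Fin 3) :
    DifferentiableAt ℝ (fun z => π z i j) y :=
  differentiableAt_of_contDiffOn (D.contDiffOn_bivector i j) D.isOpen hy

theorem differentiableAt_form (D : IsDualPair g π α w T) (hy : y ∈ T) (k : Fin 3) :
    DifferentiableAt ℝ (fun z => α z k) y :=
  differentiableAt_of_contDiffOn (D.contDiffOn_form k) D.isOpen hy

theorem differentiableAt_density (D : IsDualPair g π α w T) (hy : y ∈ T) :
    DifferentiableAt ℝ w y :=
  differentiableAt_of_contDiffOn D.contDiffOn_density D.isOpen hy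

theorem pderiv_metric_symm (D : IsDualPair g π α w T) (hy : y ∈ T) (k i j : Fin 3) :
    pderiv k (fun z => g z i j) y = pderiv k (fun z => g z j i) y :=
  pderiv_congr_of_isOpen D.isOpen hy (fun _ hz => D.metric_symm hz i j) k

theorem pderiv_inv_symm (D : IsDualPair g π α w T) (hy : y ∈ T) (k i j : Fin 3) :
    pderiv k (fun z => (g z)⁻¹ i j) y = pderiv k (fun z => (g z)⁻¹ j i) y :=
  pderiv_congr_of_isOpen D.isOpen hy (fun _ hz => D.inv_symm hz i j) k

theorem metric_mul_inv (D : IsDualPair g π α w T) (hy : y ∈ T) : g y * (g y)⁻¹ = 1 :=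
  Matrix.mul_nonsing_inv _ (D.det_pos hy).ne'.isUnit

theorem pderiv_bivector (D : IsDualPair g π α w T) (hy : y ∈ T) (k : Fin 3) :
    (Matrix.of fun i j => pderiv k (fun z => π z i j) y)
      = crossMatrix (pderiv k w y • α y + w y • fun l => pderiv k (fun z => α z l) y) := by
  have h : ∀ i j, pderiv k (fun z => π z i j) y
      = pderiv k (fun z => crossMatrix (w z • α z) i j) y := fun i j =>
    pderiv_congr_of_isOpen D.isOpen hy (fun z hz => by rw [D.bivector_eq z hz]) k
  have hw := D.differentiableAt_density hy
  have hα := D.differentiableAt_form hy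
  ext i j
  rw [Matrix.of_apply, h]
  fin_cases i <;> fin_cases j <;>
    simp [crossMatrix, pderiv_const, pderiv_neg, pderiv_mul k hw (hα _)]

/-- The logarithmic derivative of the determinant of the metric. -/
theorem sum_inv_mul_pderiv_metric (D : IsDualPair g π α w T) (hy : y ∈ T) (k : Fin 3) :
    (1 / 2) * ∑ i, ∑ j, (g y)⁻¹ i j * pderiv k (fun z => g z i j) y = -(pderiv k w y / w y) := by
  have hw := D.differentiableAt_density hy
  have hg := D.differentiableAt_metric hy
  have hw0 := D.density_ne_zero hy
  have hsq := D.sq_density y hy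
  have hdet := (D.det_pos hy).ne'
  -- Differentiate `w² det g = 1`; the derivative of the determinant is then expanded by cofactors.
  have h0 : pderiv k (fun z => w z * w z * (g z).det) y = 0 := by
    rw [pderiv_congr_of_isOpen D.isOpen hy (h := fun _ => 1)
      (fun z hz => by rw [← D.sq_density z hz]; ring), pderiv_const]
  have hd : DifferentiableAt ℝ (fun z => (g z).det) y := by
    simp only [Matrix.det_fin_three]; fun_prop
  rw [pderiv_mul k (by fun_prop) hd, pderiv_mul k hw hw] at h0
  have h1 : pderiv k (fun z => (g z).det) y
      = ∑ i, ∑ j, (g y).adjugate j i * pderiv k (fun z => g z i j) y := by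
    simp only [Matrix.det_fin_three]
    rw [pderiv_det_expansion (F := fun i j z => g z i j) hg]
    simp only [Matrix.adjugate_fin_three, Fin.sum_univ_three]
    simp
    ring
  have h2 : ∀ i j, (g y)⁻¹ i j = w y ^ 2 * (g y).adjugate j i := by
    intro i j
    rw [D.inv_symm hy, Matrix.inv_def, Ring.inverse_eq_inv, Matrix.smul_apply, smul_eq_mul,
      eq_inv_of_mul_eq_one_left hsq]
  simp only [h2, mul_assoc, ← Finset.mul_sum]
  rw [← h1]
  field_simp
  have : w y * (2 * pderiv k w y * (g y).det + w y * pderiv k (fun z => (g z).det) y) = 0 := by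
    linear_combination h0
  have h3 := (mul_eq_zero.1 this).resolve_left hw0
  linear_combination w y ^ 2 * h3 - 2 * pderiv k w y * hsq

/-- Differentiating the constant `tr(g g⁻¹) = 3` reverses the sign of the previous identity. -/
theorem sum_metric_mul_pderiv_inv (D : IsDualPair g π α w T) (hy : y ∈ T) (k : Fin 3) :
    (1 / 2) * ∑ i, ∑ j, g y i j * pderiv k (fun z => (g z)⁻¹ i j) y = pderiv k w y / w y := by
  have hg := D.differentiableAt_metric hy
  have hH := D.differentiableAt_inv hy
  have h0 : pderiv k (fun z => ∑ i, ∑ j, g z i j * (g z)⁻¹ i j) y = 0 := by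
    rw [pderiv_congr_of_isOpen D.isOpen hy (h := fun _ => 3), pderiv_const]
    intro z hz
    have h : (g z * (g z)⁻¹).trace = 3 := by simp [D.metric_mul_inv hz]
    rw [← h]
    simp only [Matrix.trace, Matrix.diag, Matrix.mul_apply]
    refine Finset.sum_congr rfl fun i _ => Finset.sum_congr rfl fun j _ => ?_
    rw [D.inv_symm hz]
  rw [pderiv_sum_sum_mul hg hH] at h0
  simp only [Finset.sum_add_distrib] at h0
  have h2 := D.sum_inv_mul_pderiv_metric hy k
  simp only [mul_comm ((g y)⁻¹ _ _)] at h2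
  linear_combination (1 / 2) * h0 - h2

/-! ### Divergence and Lie derivative in terms of the density -/

theorem christoffel_symm (D : IsDualPair g π α w T) (hy : y ∈ T) (k i j : Fin 3) :
    christoffel g k i j y = christoffel g k j i y := by
  simp only [christoffel, D.pderiv_metric_symm hy _ i j]
  congr 1
  refine Finset.sum_congr rfl fun l _ => ?_
  ring

/-- In the contraction two of the three derivative terms cancel, leaving half the logarithmic
derivative of `det g`. -/
theorem sum_christoffel (D : IsDualPair g π α w T) (hy : y ∈ T) (j : Fin 3) :
    ∑ i, christoffel g i i j y = -(pderiv j w y / w y) := by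
  rw [← D.sum_inv_mul_pderiv_metric hy]
  have h1 := D.inv_symm hy
  have h2 := D.pderiv_metric_symm hy
  simp only [christoffel, Fin.sum_univ_three, h1 1 0, h1 2 0, h1 2 1, h2 _ 1 0, h2 _ 2 0, h2 _ 2 1]
  simp only [h2 _ j]
  ring

/-- The Voss–Weyl formula `div X = w ∑ ∂ᵢ(Xⁱ / w)`. -/
theorem divVector_eq (D : IsDualPair g π α w T) (hy : y ∈ T) (X : Coord 3 → Fin 3 → ℝ) :
    divVector g X y = ∑ i, pderiv i (fun z => X z i) y - (∑ j, pderiv j w y * X y j) / w y := by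
  have h := D.sum_christoffel hy
  simp only [divVector, Finset.sum_add_distrib]
  rw [Finset.sum_comm (f := fun i j => christoffel g i i j y * X y j)]
  simp only [← Finset.sum_mul, h, Finset.sum_div, sub_eq_add_neg, ← Finset.sum_neg_distrib]
  congr 1
  refine Finset.sum_congr rfl fun i _ => ?_
  ring

theorem extDerivForm_eq_zero_iff :
    extDerivForm α y = 0 ↔ ∀ i j, pderiv i (fun z => α z j) y = pderiv j (fun z => α z i) y := by
  simp only [← Matrix.ext_iff, extDerivForm, Matrix.of_apply, Matrix.zero_apply, sub_eq_zero]

/-- The divergence of `π = w ∗ α` is `w ∗ dα`. -/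
theorem divBivector_eq_zero_iff (D : IsDualPair g π α w T) (hy : y ∈ T) :
    divBivector g π y = 0 ↔ extDerivForm α y = 0 := by
  have hw0 := D.density_ne_zero hy
  have hc := D.christoffel_symm hy
  have hs := D.sum_christoffel hy
  have hb := D.pderiv_bivector hy
  have hb' : ∀ k i j, pderiv k (fun z => π z i j) y = crossMatrix (pderiv k w y • α y
      + w y • fun l => pderiv k (fun z => α z l) y) i j := by
    intro k i j
    rw [← hb]; rfl
  simp only [Fin.sum_univ_three] at hs
  have key : ∀ k, divBivector g π y k = w y * ∑ i, crossMatrix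
      (fun l => pderiv i (fun z => α z l) y) i k := by
    intro k
    -- In `div π` the term `Γᵏᵢₗ πⁱˡ` vanishes by symmetry, and the trace of `Γ` in the other term
    -- cancels the derivatives of `w`.
    have e : ∀ j, w y * (christoffel g 0 0 j y + christoffel g 1 1 j y + christoffel g 2 2 j y)
        = -pderiv j w y := by
      intro j
      rw [hs]; field_simp
    simp only [divBivector, nablaBivector, hb', D.bivector_eq y hy]
    have e0 := e 0
    have e1 := e 1
    have e2 := e 2
    simp only [hc _ 1 0, hc _ 2 0, hc _ 2 1] at e0 e1 e2
    fin_cases k <;>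
    simp [Fin.sum_univ_three, crossMatrix, hc _ 1 0, hc _ 2 0, hc _ 2 1]
    · linear_combination α y 1 * e2 - α y 2 * e1
    · linear_combination α y 2 * e0 - α y 0 * e2
    · linear_combination α y 0 * e1 - α y 1 * e0
  rw [extDerivForm_eq_zero_iff, funext_iff]
  simp only [key, Pi.zero_apply, mul_eq_zero, hw0, false_or]
  constructor
  · intro h
    have h0 := h 0
    have h1 := h 1
    have h2 := h 2
    simp [Fin.sum_univ_three, crossMatrix] at h0 h1 h2
    intro i j
    fin_cases i <;> fin_cases j <;> simp <;> linarith
  · intro h k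
    have h0 := h 0 1
    have h1 := h 1 2
    have h2 := h 0 2
    fin_cases k <;> simp [Fin.sum_univ_three, crossMatrix] <;> linarith

/-- `L_X (w ∗ α) = w ∗ (L_X α - div X α)`. -/
theorem lieBivector_eq (D : IsDualPair g π α w T) (hy : y ∈ T) (X : Coord 3 → Fin 3 → ℝ) :
    lieBivector X π y = crossMatrix (w y • (lieForm X α y - divVector g X y • α y)) := by
  have hw0 := D.density_ne_zero hy
  have hb := D.pderiv_bivector hy
  have hb' : ∀ k i j, pderiv k (fun z => π z i j) y = crossMatrix (pderiv k w y • α y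
      + w y • fun l => pderiv k (fun z => α z l) y) i j := by
    intro k i j
    rw [← hb]; rfl
  ext j k
  simp only [lieBivector, Matrix.of_apply, hb', D.bivector_eq y hy, D.divVector_eq hy]
  fin_cases j <;> fin_cases k <;>
    simp [Fin.sum_univ_three, crossMatrix, lieForm] <;> field_simp <;> ring

theorem differentiableAt_sharp (D : IsDualPair g π α w T) (hy : y ∈ T) {β : Coord 3 → Fin 3 → ℝ}
    (hβ : ∀ i, DifferentiableAt ℝ (fun z => β z i) y) (i : Fin 3) :
    DifferentiableAt ℝ (fun z => sharp g β z i) y :=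
  differentiableAt_mulVec (D.differentiableAt_inv hy) hβ i

theorem cometric_eq_sum_sharp (D : IsDualPair g π α w T) (hy : y ∈ T) (β γ : Coord 3 → Fin 3 → ℝ) :
    cometric g β γ y = ∑ i, sharp g β y i * γ y i := by
  simp only [cometric, sharp, Finset.sum_mul]
  rw [Finset.sum_comm]
  refine Finset.sum_congr rfl fun i _ => Finset.sum_congr rfl fun j _ => ?_
  rw [D.inv_symm hy]

/-- Cartan's formula for a closed form. -/
theorem lieForm_sharp_of_closed (D : IsDualPair g π α w T) (hy : y ∈ T)
    {β γ : Coord 3 → Fin 3 → ℝ} (hβ : ∀ i, DifferentiableAt ℝ (fun z => β z i) y)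
    (hγ : ∀ i, DifferentiableAt ℝ (fun z => γ z i) y)
    (h : ∀ i j, pderiv i (fun z => γ z j) y = pderiv j (fun z => γ z i) y) :
    lieForm (sharp g β) γ y = dFun (cometric g β γ) y := by
  have hX := D.differentiableAt_sharp hy hβ
  ext k
  simp only [dFun, lieForm]
  rw [pderiv_congr_of_isOpen D.isOpen hy (fun z hz => D.cometric_eq_sum_sharp hz β γ),
    pderiv_sum _ _ (fun i _ => by fun_prop)]
  refine Finset.sum_congr rfl fun i _ => ?_
  rw [pderiv_mul k (hX i) (hγ i), h i k]
  ring

/-- For closed `α`, `L_{#α} α = d⟨α, α⟩`, and `-div(#α)` is the codifferential. -/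
theorem lieBivector_sharp_eq_zero_iff (D : IsDualPair g π α w T) (hy : y ∈ T)
    (h : extDerivForm α y = 0) :
    lieBivector (sharp g α) π y = 0 ↔
      dFun (cometric g α α) y + codifferential g α y • α y = 0 := by
  have hα := D.differentiableAt_form hy
  rw [D.lieBivector_eq hy, crossMatrix_eq_zero_iff, smul_eq_zero_iff_right (D.density_ne_zero hy),
    D.lieForm_sharp_of_closed hy hα hα (extDerivForm_eq_zero_iff.1 h), codifferential, neg_smul,
    sub_eq_add_neg]

end IsDualPair

/-! ### The metric contravariant connection in coordinates -/

theorem bilin_symm {n : ℕ} {m : Matrix (Fin n) (Fin n) ℝ} (hm : ∀ i j, m i j = m j i)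
    (u v : Fin n → ℝ) : bilin m u v = bilin m v u := by
  simp only [bilin]
  rw [Finset.sum_comm]
  refine Finset.sum_congr rfl fun _ _ => Finset.sum_congr rfl fun _ _ => ?_
  rw [hm]; ring

theorem bilin_sub_left {n : ℕ} (m : Matrix (Fin n) (Fin n) ℝ) (u u' v : Fin n → ℝ) :
    bilin m (u - u') v = bilin m u v - bilin m u' v := by
  simp only [bilin, Pi.sub_apply, mul_sub, sub_mul, Finset.sum_sub_distrib]

/-- The combination `∑ⱼ Xⱼ uⱼ` of the vectors `uⱼ`. -/
def combination {n : ℕ} (X : Fin n → ℝ) (u : Fin n → Fin n → ℝ) : Fin n → ℝ :=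
  fun k => ∑ j, X j * u j k

theorem bilin_combination_left {n : ℕ} (m : Matrix (Fin n) (Fin n) ℝ) (X : Fin n → ℝ)
    (u : Fin n → Fin n → ℝ) (v : Fin n → ℝ) :
    bilin m (combination X u) v = ∑ j, X j * bilin m (u j) v := by
  simp only [bilin, combination, Finset.mul_sum, Finset.sum_mul]
  conv_rhs => rw [Finset.sum_comm]
  refine Finset.sum_congr rfl fun _ _ => ?_
  conv_rhs => rw [Finset.sum_comm]
  refine Finset.sum_congr rfl fun _ _ => Finset.sum_congr rfl fun _ _ => ?_
  ring

theorem bilin_combination_right {n : ℕ} (m : Matrix (Fin n) (Fin n) ℝ) (X : Fin n → ℝ)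
    (u : Fin n → Fin n → ℝ) (v : Fin n → ℝ) :
    bilin m v (combination X u) = ∑ j, X j * bilin m v (u j) := by
  have h : ∀ a b, bilin m a b = bilin m.transpose b a := by
    intro a b
    simp only [bilin, Matrix.transpose_apply]
    rw [Finset.sum_comm]
    refine Finset.sum_congr rfl fun _ _ => Finset.sum_congr rfl fun _ _ => ?_
    ring
  simp only [h v, bilin_combination_left]

theorem bilin_single_right {n : ℕ} (m : Matrix (Fin n) (Fin n) ℝ) (u : Fin n → ℝ) (l : Fin n) :
    bilin m u (Pi.single l 1) = ∑ i, m i l * u i := by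
  simp [bilin, Pi.single_apply]

/-- By antisymmetry the three `∂π` contributions combine into one, and the terms pairing `π` with
derivatives of `β` and `γ` cancel. -/
theorem koszulBracket_apply {n : ℕ} {π : Coord n → Matrix (Fin n) (Fin n) ℝ}
    {β γ : Coord n → Fin n → ℝ} {y : Coord n} (hanti : ∀ i j, π y i j = -π y j i)
    (hdanti : ∀ k i j, pderiv k (fun z => π z i j) y = -pderiv k (fun z => π z j i) y)
    (hπ : ∀ i j, DifferentiableAt ℝ (fun z => π z i j) y)
    (hβ : ∀ i, DifferentiableAt ℝ (fun z => β z i) y)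
    (hγ : ∀ i, DifferentiableAt ℝ (fun z => γ z i) y) :
    koszulBracket π β γ y =
      combination (anchorAt (π y) (β y)) (fun j k => pderiv j (fun z => γ z k) y)
        - combination (anchorAt (π y) (γ y)) (fun j k => pderiv j (fun z => β z k) y)
        + fun k => bilin (Matrix.of fun i j => pderiv k (fun z => π z i j) y) (β y) (γ y) := by
  ext k
  have hanchor : ∀ (u v : Coord n → Fin n → ℝ) (hu : ∀ i, DifferentiableAt ℝ (fun z => u z i) y),
      ∑ i, v y i * pderiv k (fun z => anchor π u z i) y =
        bilin (Matrix.of fun i j => pderiv k (fun z => π z i j) y) (u y) (v y)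
          + bilin (π y) (fun i => pderiv k (fun z => u z i) y) (v y) := by
    intro u v hu
    have h1 : ∀ i, pderiv k (fun z => anchor π u z i) y = _ := fun i =>
      pderiv_mulVec (m := fun z => (π z).transpose) (fun i j => hπ j i) hu k i
    simp only [h1, bilin, Matrix.transpose_apply, Matrix.of_apply, Finset.mul_sum, mul_add,
      Finset.sum_add_distrib]
    congr 1 <;>
    · rw [Finset.sum_comm]
      refine Finset.sum_congr rfl fun _ _ => Finset.sum_congr rfl fun _ _ => ?_
      ring
  have hskew : ∀ (m : Matrix (Fin n) (Fin n) ℝ), (∀ i j, m i j = -m j i) → ∀ u v,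
      bilin m u v = -bilin m v u := by
    intro m hm u v
    simp only [bilin, ← Finset.sum_neg_distrib]
    rw [Finset.sum_comm]
    refine Finset.sum_congr rfl fun i _ => Finset.sum_congr rfl fun j _ => ?_
    rw [hm]; ring
  simp only [koszulBracket, Pi.sub_apply, Pi.add_apply, lieForm, Finset.sum_add_distrib, dFun,
    hanchor β γ hβ, hanchor γ β hγ]
  have h2 : pderiv k (pairing π β γ) y = _ := pderiv_bilin hπ hβ hγ k
  rw [h2, hskew _ hanti (fun i => pderiv k (fun z => γ z i) y) (β y),
    hskew (Matrix.of fun i j => pderiv k (fun z => π z i j) y) (hdanti k) (γ y) (β y)]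
  simp only [combination, anchor, anchorAt]
  ring

/-- Derivatives of `β` and `δ` drop out, so the Koszul formula is tensorial in them and a derivation
in `γ`. What is left is a polynomial in first jets. -/
theorem koszulRHS_eq {n : ℕ} {g π : Coord n → Matrix (Fin n) (Fin n) ℝ}
    {β γ δ : Coord n → Fin n → ℝ} {y : Coord n}
    (hsymm : ∀ i j, (g y)⁻¹ i j = (g y)⁻¹ j i)
    (hg : ∀ i j, DifferentiableAt ℝ (fun z => (g z)⁻¹ i j) y)
    (hanti : ∀ i j, π y i j = -π y j i)
    (hdanti : ∀ k i j, pderiv k (fun z => π z i j) y = -pderiv k (fun z => π z j i) y)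
    (hπ : ∀ i j, DifferentiableAt ℝ (fun z => π z i j) y)
    (hβ : ∀ i, DifferentiableAt ℝ (fun z => β z i) y)
    (hγ : ∀ i, DifferentiableAt ℝ (fun z => γ z i) y)
    (hδ : ∀ i, DifferentiableAt ℝ (fun z => δ z i) y) :
    koszulRHS g π β γ δ y =
      2 * bilin (g y)⁻¹
          (combination (anchorAt (π y) (β y)) (fun j k => pderiv j (fun z => γ z k) y)) (δ y)
        + koszulTensor (g y)⁻¹ (fun k => Matrix.of fun i j => pderiv k (fun z => (g z)⁻¹ i j) y)
            (π y) (fun k => Matrix.of fun i j => pderiv k (fun z => π z i j) y)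
            (β y) (γ y) (δ y) := by
  have hd : ∀ (u v t : Coord n → Fin n → ℝ) (_ : ∀ i, DifferentiableAt ℝ (fun z => u z i) y)
      (_ : ∀ i, DifferentiableAt ℝ (fun z => v z i) y),
      derivAlong (anchor π t) (cometric g u v) y =
        ∑ j, anchorAt (π y) (t y) j *
          bilin (Matrix.of fun a b => pderiv j (fun z => (g z)⁻¹ a b) y) (u y) (v y)
        + bilin (g y)⁻¹ (combination (anchorAt (π y) (t y))
            (fun j k => pderiv j (fun z => u z k) y)) (v y)
        + bilin (g y)⁻¹ (u y) (combination (anchorAt (π y) (t y))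
            (fun j k => pderiv j (fun z => v z k) y)) := by
    intro u v t hu hv
    rw [bilin_combination_left, bilin_combination_right]
    simp only [derivAlong, ← Finset.sum_add_distrib]
    refine Finset.sum_congr rfl fun j _ => ?_
    have : pderiv j (cometric g u v) y = _ := pderiv_bilin (m := fun z => (g z)⁻¹) hg hu hv j
    rw [this]
    simp only [anchor, anchorAt]
    ring
  have hc : ∀ u v : Coord n → Fin n → ℝ, cometric g u v y = bilin (g y)⁻¹ (u y) (v y) :=
    fun _ _ => rfl
  simp only [koszulRHS, Pi.add_apply, Pi.sub_apply, hd _ _ _ hγ hδ, hd _ _ _ hβ hδ,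
    hd _ _ _ hβ hγ, hc, koszulBracket_apply hanti hdanti hπ hδ hβ,
    koszulBracket_apply hanti hdanti hπ hδ hγ, koszulBracket_apply hanti hdanti hπ hβ hγ,
    bilin_add_left, bilin_sub_left, koszulTensor]
  rw [bilin_symm hsymm (γ y) (combination _ _), bilin_symm hsymm (β y) (combination _ _),
    bilin_symm hsymm (β y) (combination _ _)]
  ring

namespace IsDualPair

variable {g π : Coord 3 → Matrix (Fin 3) (Fin 3) ℝ} {α : Coord 3 → Fin 3 → ℝ}
  {w : Coord 3 → ℝ} {T : Set (Coord 3)} {y : Coord 3}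

theorem mono (D : IsDualPair g π α w T) {S : Set (Coord 3)} (hS : IsOpen S) (hST : S ⊆ T) :
    IsDualPair g π α w S where
  isOpen := hS
  contDiffOn_metric i j := (D.contDiffOn_metric i j).mono hST
  posDef y hy := D.posDef y (hST hy)
  contDiffOn_density := D.contDiffOn_density.mono hST
  contDiffOn_form k := (D.contDiffOn_form k).mono hST
  sq_density y hy := D.sq_density y (hST hy)
  bivector_eq y hy := D.bivector_eq y (hST hy)

theorem crossMatrix_antisymm (v : Fin 3 → ℝ) (i j : Fin 3) :
    crossMatrix v i j = -crossMatrix v j i := by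
  fin_cases i <;> fin_cases j <;> simp [crossMatrix]

theorem bivector_antisymm (D : IsDualPair g π α w T) (hy : y ∈ T) (i j : Fin 3) :
    π y i j = -π y j i := by
  rw [D.bivector_eq y hy, crossMatrix_antisymm]

theorem pderiv_bivector_antisymm (D : IsDualPair g π α w T) (hy : y ∈ T) (k i j : Fin 3) :
    pderiv k (fun z => π z i j) y = -pderiv k (fun z => π z j i) y := by
  rw [← pderiv_neg]
  exact pderiv_congr_of_isOpen D.isOpen hy (fun z hz => D.bivector_antisymm hz i j) k

variable (g π y) in
/-- The jets entering the tensorial part of the metric contravariant connection. -/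
def symbolAt : (Fin 3 → ℝ) → (Fin 3 → ℝ) → Fin 3 → ℝ :=
  contraSymbol (g y) (g y)⁻¹ (fun k => Matrix.of fun i j => pderiv k (fun z => (g z)⁻¹ i j) y)
    (π y) (fun k => Matrix.of fun i j => pderiv k (fun z => π z i j) y)

variable (g π α y) in
/-- The covariant derivative `𝒟_β α` at `y`. -/
def covForm (β : Fin 3 → ℝ) : Fin 3 → ℝ :=
  fun k => ∑ j, anchorAt (π y) β j * pderiv j (fun z => α z k) y + symbolAt g π y β (α y) k

theorem sum_metric_mul_bilin (D : IsDualPair g π α w T) (hy : y ∈ T) (u : Fin 3 → ℝ) (k : Fin 3) :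
    ∑ l, g y k l * bilin (g y)⁻¹ u (Pi.single l 1) = u k := by
  have h := congrArg (fun m : Matrix (Fin 3) (Fin 3) ℝ => m.mulVec u k) (D.metric_mul_inv hy)
  simp only [Matrix.one_mulVec, ← Matrix.mulVec_mulVec] at h
  rw [← h]
  simp only [bilin_single_right, Matrix.mulVec, dotProduct]
  refine Finset.sum_congr rfl fun l _ => ?_
  congr 1
  exact Finset.sum_congr rfl fun i _ => by rw [D.inv_symm hy]

theorem contravariantD_apply (D : IsDualPair g π α w T) (hy : y ∈ T) {β γ : Coord 3 → Fin 3 → ℝ}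
    (hβ : ∀ i, DifferentiableAt ℝ (fun z => β z i) y)
    (hγ : ∀ i, DifferentiableAt ℝ (fun z => γ z i) y) :
    contravariantD g π β γ y =
      combination (anchorAt (π y) (β y)) (fun j k => pderiv j (fun z => γ z k) y)
        + symbolAt g π y (β y) (γ y) := by
  ext k
  have h : ∀ l, koszulRHS g π β γ (dx l) y = _ := fun l =>
    koszulRHS_eq (δ := dx l) (D.inv_symm hy) (D.differentiableAt_inv hy) (D.bivector_antisymm hy)
      (D.pderiv_bivector_antisymm hy) (D.differentiableAt_bivector hy) hβ hγ
      (fun i => differentiableAt_const _)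
  simp only [contravariantD, h, dx, Pi.add_apply, symbolAt, contraSymbol]
  rw [← D.sum_metric_mul_bilin hy (combination _ _) k, ← Finset.sum_add_distrib]
  refine Finset.sum_congr rfl fun l _ => ?_
  ring

/-- `𝒟` preserves the volume element, so differentiating `π = w ∗ α` only differentiates `α`. -/
theorem contravariantDπ_apply (D : IsDualPair g π α w T) (hy : y ∈ T)
    {β γ δ : Coord 3 → Fin 3 → ℝ}
    (hβ : ∀ i, DifferentiableAt ℝ (fun z => β z i) y)
    (hγ : ∀ i, DifferentiableAt ℝ (fun z => γ z i) y)
    (hδ : ∀ i, DifferentiableAt ℝ (fun z => δ z i) y) :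
    contravariantDπ g π β γ δ y =
      w y * bilin (crossMatrix (covForm g π α y (β y))) (γ y) (δ y) := by
  have hw0 := D.density_ne_zero hy
  have htr := contraSymbol_trace (dp := fun k => Matrix.of fun i j => pderiv k (fun z => π z i j) y)
    (dH := fun k => Matrix.of fun i j => pderiv k (fun z => (g z)⁻¹ i j) y)
    (D.metric_symm hy) (D.inv_symm hy) (D.pderiv_inv_symm hy) (D.pderiv_bivector_antisymm hy)
    (D.sum_metric_mul_pderiv_inv hy) (p := π y) (β y)
  have htr' : w y * ∑ k, contraSymbol (g y) (g y)⁻¹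
      (fun k => Matrix.of fun i j => pderiv k (fun z => (g z)⁻¹ i j) y)
      (π y) (fun k => Matrix.of fun i j => pderiv k (fun z => π z i j) y) (β y) (Pi.single k 1) k
      = ∑ j, anchorAt (π y) (β y) j * pderiv j w y := by
    rw [htr, Finset.mul_sum]
    refine Finset.sum_congr rfl fun j _ => ?_
    field_simp
  have key := parallel_defect_eq (D.bivector_eq y hy) (D.pderiv_bivector hy) (β y) (γ y) (δ y) htr'
  refine Eq.trans ?_ key
  have hp : ∀ j, pderiv j (pairing π γ δ) y = _ := fun j =>
    pderiv_bilin (D.differentiableAt_bivector hy) hγ hδ j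
  have hpair : ∀ u v : Coord 3 → Fin 3 → ℝ, pairing π u v y = bilin (π y) (u y) (v y) :=
    fun _ _ => rfl
  simp only [contravariantDπ, Pi.sub_apply, hpair, D.contravariantD_apply hy hβ hγ,
    D.contravariantD_apply hy hβ hδ, derivAlong, hp, bilin_add_left, bilin_add_right, mul_add,
    Finset.sum_add_distrib, bilin_combination_left, bilin_combination_right, symbolAt]
  simp only [anchor, anchorAt]
  ring

/-- The first sum is antisymmetric in `(β, δ)` because `π` is, and the other two are exchanged by
swapping `β` and `δ`; so the two parts vanish separately when `𝒟α = 0`. -/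
theorem two_mul_bilin_covForm (D : IsDualPair g π α w T) (hy : y ∈ T) (β δ : Fin 3 → ℝ) :
    2 * bilin (g y)⁻¹ (covForm g π α y β) δ =
      -∑ j, ∑ k, lieBivector (sharp g α) π y j k * β j * δ k
        + ∑ i, ∑ j, extDerivForm α y i j * anchorAt (π y) β i * (∑ l, (g y)⁻¹ j l * δ l)
        + ∑ i, ∑ j, extDerivForm α y i j * anchorAt (π y) δ i * (∑ l, (g y)⁻¹ j l * β l) := by
  have hX : ∀ k i, pderiv k (fun z => sharp g α z i) y = _ := fun k i =>
    pderiv_mulVec (m := fun z => (g z)⁻¹) (D.differentiableAt_inv hy) (D.differentiableAt_form hy)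
      k i
  have key := koszulTensor_dual_form
    (dH := fun k => Matrix.of fun i j => pderiv k (fun z => (g z)⁻¹ i j) y)
    (D.inv_symm hy) (D.pderiv_inv_symm hy) (D.bivector_eq y hy) (D.pderiv_bivector hy) β δ
  simp only [extDerivForm, lieBivector, Matrix.of_apply, hX]
  simp only [Matrix.of_apply] at key
  simp only [sharp]
  rw [← key]
  have hsplit : covForm g π α y β = (fun k => ∑ j, anchorAt (π y) β j * pderiv j (fun z => α z k) y)
      + symbolAt g π y β (α y) := rfl
  rw [hsplit, bilin_add_left, mul_add]
  congr 1
  rw [koszulTensor_linear_right]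
  have hsym : ∀ m, koszulTensor (g y)⁻¹
      (fun k => Matrix.of fun i j => pderiv k (fun z => (g z)⁻¹ i j) y)
      (π y) (fun k => Matrix.of fun i j => pderiv k (fun z => π z i j) y) β (α y) (Pi.single m 1)
      = 2 * ∑ k, (g y)⁻¹ m k * symbolAt g π y β (α y) k := by
    intro m
    have h1 := congrArg (fun A : Matrix (Fin 3) (Fin 3) ℝ => A.mulVec (fun l => koszulTensor (g y)⁻¹
      (fun k => Matrix.of fun i j => pderiv k (fun z => (g z)⁻¹ i j) y)
      (π y) (fun k => Matrix.of fun i j => pderiv k (fun z => π z i j) y) β (α y)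
      (Pi.single l 1)) m) (Matrix.nonsing_inv_mul (g y) (D.det_pos hy).ne'.isUnit)
    simp only [Matrix.one_mulVec, ← Matrix.mulVec_mulVec] at h1
    rw [← h1]
    simp only [Matrix.mulVec, dotProduct, symbolAt, contraSymbol, Finset.mul_sum]
    refine Finset.sum_congr rfl fun i _ => Finset.sum_congr rfl fun j _ => ?_
    ring
  simp only [hsym, bilin, Finset.mul_sum]
  rw [Finset.sum_comm]
  refine Finset.sum_congr rfl fun i _ => Finset.sum_congr rfl fun j _ => ?_
  rw [D.inv_symm hy]
  ring

/-! ### Parallelism of the bivector as equations on the dual form -/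

theorem bilin_inv_eq_zero (D : IsDualPair g π α w T) (hy : y ∈ T) {u : Fin 3 → ℝ}
    (h : ∀ δ, bilin (g y)⁻¹ u δ = 0) : u = 0 := by
  ext k
  rw [← D.sum_metric_mul_bilin hy u k]
  simp [h]

theorem contravariantDπ_eq_zero (D : IsDualPair g π α w T) (hy : y ∈ T)
    (hext : extDerivForm α y = 0) (hlie : lieBivector (sharp g α) π y = 0)
    {β γ δ : Coord 3 → Fin 3 → ℝ}
    (hβ : ∀ i, DifferentiableAt ℝ (fun z => β z i) y)
    (hγ : ∀ i, DifferentiableAt ℝ (fun z => γ z i) y)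
    (hδ : ∀ i, DifferentiableAt ℝ (fun z => δ z i) y) :
    contravariantDπ g π β γ δ y = 0 := by
  have h : covForm g π α y (β y) = 0 := D.bilin_inv_eq_zero hy fun δ => by
    have := D.two_mul_bilin_covForm hy (β y) δ
    simp only [hext, hlie] at this
    simpa using this
  rw [D.contravariantDπ_apply hy hβ hγ hδ, h, crossMatrix_eq_zero_iff.2 rfl]
  simp [bilin]

theorem crossMatrix_eq_zero_of_bilin {v : Fin 3 → ℝ}
    (h : ∀ γ δ, bilin (crossMatrix v) γ δ = 0) : v = 0 := by
  rw [← crossMatrix_eq_zero_iff]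
  ext i j
  have := h (Pi.single i 1) (Pi.single j 1)
  rw [bilin_single_right] at this
  simpa [Pi.single_apply] using this

theorem exists_extDerivForm_eq (α : Coord 3 → Fin 3 → ℝ) (y : Coord 3) :
    ∃ c, extDerivForm α y = crossMatrix c := by
  refine ⟨![extDerivForm α y 1 2, extDerivForm α y 2 0, extDerivForm α y 0 1], ?_⟩
  ext i j
  fin_cases i <;> fin_cases j <;> simp [extDerivForm, crossMatrix]

/-- Constant forms suffice since `𝒟π` is tensorial. The symmetric part of `𝒟α = 0` gives the
alternative; once `dα = 0`, only the Lie derivative term remains. -/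
theorem eq_zero_or_of_parallel (D : IsDualPair g π α w T) (hy : y ∈ T)
    (h : ∀ β γ δ : Fin 3 → ℝ,
      contravariantDπ g π (fun _ => β) (fun _ => γ) (fun _ => δ) y = 0) :
    (α y = 0 ∨ extDerivForm α y = 0) ∧
      (extDerivForm α y = 0 → lieBivector (sharp g α) π y = 0) := by
  have hcov : ∀ β, covForm g π α y β = 0 := by
    intro β
    apply crossMatrix_eq_zero_of_bilin
    intro γ δ
    have := h β γ δ
    rw [D.contravariantDπ_apply (β := fun _ => β) (γ := fun _ => γ) (δ := fun _ => δ) hy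
      (fun _ => differentiableAt_const _)
      (fun _ => differentiableAt_const _) (fun _ => differentiableAt_const _)] at this
    exact (mul_eq_zero.1 this).resolve_left (D.density_ne_zero hy)
  have hsum : ∀ β δ, -∑ j, ∑ k, lieBivector (sharp g α) π y j k * β j * δ k
        + ∑ i, ∑ j, extDerivForm α y i j * anchorAt (π y) β i * (∑ l, (g y)⁻¹ j l * δ l)
        + ∑ i, ∑ j, extDerivForm α y i j * anchorAt (π y) δ i * (∑ l, (g y)⁻¹ j l * β l) = 0 := by
    intro β δ
    rw [← D.two_mul_bilin_covForm hy, hcov]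
    simp [bilin]
  constructor
  · obtain ⟨c, hc⟩ := exists_extDerivForm_eq α y
    rw [hc, crossMatrix_eq_zero_iff]
    refine eq_zero_or_curl_eq_zero (D.density_ne_zero hy) (D.posDef y hy).inv (D.bivector_eq y hy) ?_
    intro β δ
    have h1 := hsum β δ
    have h2 := hsum δ β
    rw [← hc]
    -- Adding the equations for `(β, δ)` and `(δ, β)` removes the antisymmetric term.
    have h3 : ∑ j, ∑ k, lieBivector (sharp g α) π y j k * β j * δ k
        = -∑ j, ∑ k, lieBivector (sharp g α) π y j k * δ j * β k := by
      rw [D.lieBivector_eq hy, Finset.sum_comm, ← Finset.sum_neg_distrib]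
      refine Finset.sum_congr rfl fun i _ => ?_
      rw [← Finset.sum_neg_distrib]
      refine Finset.sum_congr rfl fun j _ => ?_
      rw [crossMatrix_antisymm]
      ring
    linarith
  · intro hext
    ext i j
    have := hsum (Pi.single i 1) (Pi.single j 1)
    simp only [hext] at this
    simpa [Pi.single_apply] using this

/-- A continuous function which vanishes wherever `α` does not, and on the interior of the zero set
of `α`, is zero. -/
theorem eq_zero_of_or {F : Coord 3 → ℝ} (hT : IsOpen T) (hF : ContinuousOn F T)
    (h : ∀ z ∈ T, α z = 0 ∨ F z = 0)
    (h0 : ∀ z ∈ T, (∀ᶠ x in nhds z, α x = 0) → F z = 0) (hy : y ∈ T) : F y = 0 := by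
  by_contra hne
  refine hne (h0 y hy ?_)
  filter_upwards [(hF.continuousAt (hT.mem_nhds hy)).eventually_ne hne, hT.mem_nhds hy]
    with z hz hzT using (h z hzT).resolve_right hz

/-- Near a point with `dα ≠ 0` the form `α` would vanish identically, and then so would `dα`. -/
theorem extDerivForm_eq_zero_of_or (D : IsDualPair g π α w T)
    (h : ∀ z ∈ T, α z = 0 ∨ extDerivForm α z = 0) (hy : y ∈ T) : extDerivForm α y = 0 := by
  ext i j
  refine eq_zero_of_or (F := fun z => extDerivForm α z i j) (α := α) D.isOpen ?_ ?_ ?_ hy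
  · exact ((contDiffOn_pderiv D.isOpen (D.contDiffOn_form j) i).sub
      (contDiffOn_pderiv D.isOpen (D.contDiffOn_form i) j)).continuousOn
  · intro z hz
    refine (h z hz).imp_right fun h => by rw [h]; rfl
  · intro z _ h0
    have : ∀ a b, pderiv a (fun x => α x b) z = 0 := fun a b => by
      rw [pderiv_congr a (h := fun _ => 0) (h0.mono fun x hx => by simp [hx]), pderiv_const]
    simp [extDerivForm, this]

/-- `𝒟π = 0` in terms of the dual form. -/
theorem parallel_iff (D : IsDualPair g π α w T) :
    (∀ β γ δ : Coord 3 → Fin 3 → ℝ, ContDiffOn ℝ ∞ β T → ContDiffOn ℝ ∞ γ T →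
      ContDiffOn ℝ ∞ δ T → ∀ y ∈ T, contravariantDπ g π β γ δ y = 0) ↔
    ∀ y ∈ T, extDerivForm α y = 0 ∧
      dFun (cometric g α α) y + codifferential g α y • α y = 0 := by
  constructor
  · intro h
    have h' := fun y hy => D.eq_zero_or_of_parallel (y := y) hy fun β γ δ =>
      h _ _ _ contDiffOn_const contDiffOn_const contDiffOn_const y hy
    intro y hy
    have hext := D.extDerivForm_eq_zero_of_or (fun z hz => (h' z hz).1) hy
    exact ⟨hext, (D.lieBivector_sharp_eq_zero_iff hy hext).1 ((h' y hy).2 hext)⟩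
  · intro h β γ δ hβ hγ hδ y hy
    have hd : ∀ {u : Coord 3 → Fin 3 → ℝ}, ContDiffOn ℝ ∞ u T →
        ∀ i, DifferentiableAt ℝ (fun z => u z i) y := fun hu i =>
      differentiableAt_of_contDiffOn (contDiffOn_pi.1 hu i) D.isOpen hy
    exact D.contravariantDπ_eq_zero hy (h y hy).1
      ((D.lieBivector_sharp_eq_zero_iff hy (h y hy).1).2 (h y hy).2) (hd hβ) (hd hγ) (hd hδ)

end IsDualPair

/-! ### Poisson brackets and Casimir functions in coordinates -/

namespace IsDualPair

variable {g π : Coord 3 → Matrix (Fin 3) (Fin 3) ℝ} {α : Coord 3 → Fin 3 → ℝ}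
  {w : Coord 3 → ℝ} {T : Set (Coord 3)} {y : Coord 3}

/-- The Jacobiator is a multiple of `α ∧ dα`: derivatives of `w` and the symmetric second
derivatives of the functions cancel. -/
theorem jacobi (D : IsDualPair g π α w T) (hy : y ∈ T) (hext : extDerivForm α y = 0)
    {f h k : Coord 3 → ℝ} (hf : ContDiffAt ℝ ∞ f y) (hh : ContDiffAt ℝ ∞ h y)
    (hk : ContDiffAt ℝ ∞ k y) :
    bilin (π y) (dFun f y) (dFun (fun z => bilin (π z) (dFun h z) (dFun k z)) y)
      + bilin (π y) (dFun h y) (dFun (fun z => bilin (π z) (dFun k z) (dFun f z)) y)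
      + bilin (π y) (dFun k y) (dFun (fun z => bilin (π z) (dFun f z) (dFun h z)) y) = 0 := by
  have hd : ∀ {u : Coord 3 → ℝ}, ContDiffAt ℝ ∞ u y →
      ∀ i, DifferentiableAt ℝ (fun z => dFun u z i) y := by
    intro u hu i
    have : DifferentiableAt ℝ (fderiv ℝ u) y :=
      (hu.fderiv_right (m := ∞) (by simp)).differentiableAt (by simp)
    simp only [dFun, pderiv]
    fun_prop
  have hb : ∀ {u v : Coord 3 → ℝ}, ContDiffAt ℝ ∞ u y → ContDiffAt ℝ ∞ v y → ∀ i,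
      dFun (fun z => bilin (π z) (dFun u z) (dFun v z)) y i = _ := fun hu hv i =>
    pderiv_bilin (D.differentiableAt_bivector hy) (hd hu) (hd hv) i
  have hdd : ∀ u : Coord 3 → ℝ, ∀ i j, pderiv i (fun z => dFun u z j) y
      = pderiv i (pderiv j u) y := fun _ _ _ => rfl
  have hcurl := extDerivForm_eq_zero_iff.1 hext
  have c1 := hcurl 1 0
  have c2 := hcurl 2 0
  have c3 := hcurl 2 1
  simp only [bilin.eq_1 (π y) _ (dFun _ y), hb hh hk, hb hk hf, hb hf hh, hdd,
    D.pderiv_bivector hy]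
  have f1 := pderiv_comm hf 1 0
  have f2 := pderiv_comm hf 2 0
  have f3 := pderiv_comm hf 2 1
  have h1 := pderiv_comm hh 1 0
  have h2 := pderiv_comm hh 2 0
  have h3 := pderiv_comm hh 2 1
  have k1 := pderiv_comm hk 1 0
  have k2 := pderiv_comm hk 2 0
  have k3 := pderiv_comm hk 2 1
  simp only [D.bivector_eq y hy, bilin, crossMatrix, Fin.sum_univ_three, Pi.smul_apply,
    Pi.add_apply, smul_eq_mul, Matrix.of_apply, Matrix.cons_val', Matrix.cons_val_zero,
    Matrix.cons_val_one, Matrix.cons_val, Matrix.cons_val_fin_one, f1, f2, f3, h1, h2, h3,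
    k1, k2, k3, c1, c2, c3]
  ring

/-- The cometric square norm of a nonzero form is positive. -/
theorem cometric_self_pos (D : IsDualPair g π α w T) (hy : y ∈ T) {β : Coord 3 → Fin 3 → ℝ}
    (hβ : β y ≠ 0) : 0 < cometric g β β y := by
  have := (D.posDef y hy).inv.dotProduct_mulVec_pos hβ
  simp only [dotProduct, Matrix.mulVec, Fin.sum_univ_three, cometric, star_trivial] at this ⊢
  linarith

theorem differentiableAt_cometric (D : IsDualPair g π α w T) (hy : y ∈ T)
    {β γ : Coord 3 → Fin 3 → ℝ} (hβ : ∀ i, DifferentiableAt ℝ (fun z => β z i) y)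
    (hγ : ∀ i, DifferentiableAt ℝ (fun z => γ z i) y) :
    DifferentiableAt ℝ (cometric g β γ) y := by
  have hX := D.differentiableAt_sharp hy hβ
  refine DifferentiableAt.congr_of_eventuallyEq (f := fun z => ∑ i, sharp g β z i * γ z i)
    (by fun_prop) ?_
  filter_upwards [D.isOpen.mem_nhds hy] with z hz using D.cometric_eq_sum_sharp hz β γ

/-- The anchor sends `v` to `w` times `α × v`, so its kernel is given by `v ∧ α = 0`. -/
theorem casimir_iff (D : IsDualPair g π α w T) (hy : y ∈ T) (v : Fin 3 → ℝ) :
    anchorAt (π y) v = 0 ↔ ∀ i j, v i * α y j = v j * α y i := by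
  have hw := D.density_ne_zero hy
  constructor
  · intro h
    have h0 := congrFun h 0
    have h1 := congrFun h 1
    have h2 := congrFun h 2
    simp [anchorAt, D.bivector_eq y hy, crossMatrix, Fin.sum_univ_three] at h0 h1 h2
    have e0 : v 1 * α y 2 = v 2 * α y 1 := mul_left_cancel₀ hw (by linear_combination -h0)
    have e1 : v 2 * α y 0 = v 0 * α y 2 := mul_left_cancel₀ hw (by linear_combination -h1)
    have e2 : v 0 * α y 1 = v 1 * α y 0 := mul_left_cancel₀ hw (by linear_combination -h2)
    intro i j
    fin_cases i <;> fin_cases j <;> simp [e0, e1, e2]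
  · intro h
    ext k
    have e0 := h 1 2
    have e1 := h 2 0
    have e2 := h 0 1
    fin_cases k <;> simp [anchorAt, D.bivector_eq y hy, crossMatrix, Fin.sum_univ_three]
    · linear_combination -w y * e0
    · linear_combination -w y * e1
    · linear_combination -w y * e2

theorem lieBivector_gradient_of_ne_zero (D : IsDualPair g π α w T)
    (h : ∀ y ∈ T, extDerivForm α y = 0 ∧
      dFun (cometric g α α) y + codifferential g α y • α y = 0)
    {f : Coord 3 → ℝ} (hf : ContDiffOn ℝ ∞ f T)
    (hcas : ∀ y ∈ T, anchorAt (π y) (dFun f y) = 0) (hy : y ∈ T) (hα0 : α y ≠ 0) :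
    lieBivector (gradient g f) π y = 0 := by
  have hext := extDerivForm_eq_zero_iff.1 (h y hy).1
  have hα := D.differentiableAt_form hy
  have hdf : ∀ i, DifferentiableAt ℝ (fun z => dFun f z i) y := fun i =>
    differentiableAt_of_contDiffOn (contDiffOn_pderiv D.isOpen hf i) D.isOpen hy
  have hNpos := D.cometric_self_pos hy hα0
  have hN := D.differentiableAt_cometric hy hα hα
  have hP := D.differentiableAt_cometric hy hdf hα
  rw [D.lieBivector_eq hy, gradient, D.lieForm_sharp_of_closed hy hdf hα hext,
    crossMatrix_eq_zero_iff, smul_eq_zero_iff_right (D.density_ne_zero hy), sub_eq_zero]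
  -- Near `y` the Casimir condition makes `df` a multiple of `α`; pairing with `α` determines the
  -- factor.
  set q : Coord 3 → ℝ := fun z => cometric g (dFun f) α z / cometric g α α z with hq
  have hqd : DifferentiableAt ℝ q y := by
    simp only [hq, div_eq_mul_inv]
    exact hP.mul (hN.inv hNpos.ne')
  have hev : ∀ᶠ z in nhds y, z ∈ T ∧ α z ≠ 0 := by
    have hc : ContinuousAt α y := continuousAt_pi.2 fun i => (hα i).continuousAt
    have hyT : ∀ᶠ z in nhds y, z ∈ T := D.isOpen.mem_nhds hy
    exact hyT.and (hc.eventually_ne hα0)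
  have hfq : ∀ᶠ z in nhds y, ∀ k, dFun f z k = q z * α z k := by
    filter_upwards [hev] with z hz k
    have hNz := D.cometric_self_pos hz.1 hz.2
    have hc := (D.casimir_iff hz.1 _).1 (hcas z hz.1)
    rw [hq, div_mul_eq_mul_div, eq_div_iff hNz.ne']
    simp only [cometric, Finset.mul_sum, Finset.sum_mul]
    refine Finset.sum_congr rfl fun i _ => Finset.sum_congr rfl fun j _ => ?_
    linear_combination (g z)⁻¹ i j * α z j * hc k i
  have hpq : ∀ᶠ z in nhds y, cometric g (dFun f) α z = q z * cometric g α α z := by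
    filter_upwards [hev] with z hz
    rw [hq, div_mul_cancel₀ _ (D.cometric_self_pos hz.1 hz.2).ne']
  have hXq : ∀ i, ∀ᶠ z in nhds y, sharp g (dFun f) z i = q z * sharp g α z i := by
    intro i
    filter_upwards [hfq] with z hz
    simp only [sharp, hz, Finset.mul_sum]
    exact Finset.sum_congr rfl fun j _ => by ring
  have hXα := D.differentiableAt_sharp hy hα
  -- `0 = d(df) = d(q α) = dq ∧ α`, because `α` is closed.
  have hdq : ∀ i k, pderiv i q y * α y k = pderiv k q y * α y i := by
    intro i k
    have e1 : ∀ a b, pderiv a (pderiv b f) y = pderiv a q y * α y b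
        + q y * pderiv a (fun z => α z b) y := fun a b => by
      rw [← pderiv_mul a hqd (hα b)]
      exact pderiv_congr a (hfq.mono fun z hz => hz b)
    have e2 := pderiv_comm (hf.contDiffAt (D.isOpen.mem_nhds hy)) i k
    rw [e1, e1, hext i k] at e2
    linarith
  have hdiv : divVector g (sharp g (dFun f)) y
      = q y * divVector g (sharp g α) y + ∑ i, pderiv i q y * sharp g α y i := by
    rw [D.divVector_eq hy, D.divVector_eq hy]
    have e : ∀ i, pderiv i (fun z => sharp g (dFun f) z i) y
        = pderiv i q y * sharp g α y i + q y * pderiv i (fun z => sharp g α z i) y := fun i => by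
      rw [← pderiv_mul i hqd (hXα i)]
      exact pderiv_congr i (hXq i)
    simp only [e, (hXq _).self_of_nhds, Fin.sum_univ_three]
    ring
  ext k
  have hk := congrFun (h y hy).2 k
  have hNk := D.cometric_eq_sum_sharp hy α α
  simp only [codifferential, Pi.add_apply, Pi.smul_apply, smul_eq_mul, Pi.zero_apply] at hk ⊢
  have e : dFun (cometric g (dFun f) α) y k
      = pderiv k q y * cometric g α α y + q y * dFun (cometric g α α) y k := by
    rw [dFun, pderiv_congr k hpq, pderiv_mul k hqd hN, dFun]
  rw [e, hdiv, hNk]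
  simp only [Fin.sum_univ_three]
  -- Besides `q` times the equation for `α` there remains `⟨α, α⟩ dq - ⟨dq, α⟩ α`, which vanishes
  -- because `dq ∧ α = 0`.
  linear_combination q y * hk - sharp g α y 0 * hdq 0 k - sharp g α y 1 * hdq 1 k
    - sharp g α y 2 * hdq 2 k

theorem contDiffOn_gradient (D : IsDualPair g π α w T) {f : Coord 3 → ℝ} (hf : ContDiffOn ℝ ∞ f T)
    (i : Fin 3) : ContDiffOn ℝ ∞ (fun z => gradient g f z i) T := by
  simp only [gradient, sharp, dFun]
  exact ContDiffOn.sum fun j _ => (D.contDiffOn_inv i j).mul (contDiffOn_pderiv D.isOpen hf j)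

/-- Extends the case `α ≠ 0` by continuity; on the interior of the zero set of `α`, `π` and its
first derivatives vanish. -/
theorem lieBivector_gradient_eq_zero (D : IsDualPair g π α w T)
    (h : ∀ y ∈ T, extDerivForm α y = 0 ∧
      dFun (cometric g α α) y + codifferential g α y • α y = 0)
    {f : Coord 3 → ℝ} (hf : ContDiffOn ℝ ∞ f T)
    (hcas : ∀ y ∈ T, anchorAt (π y) (dFun f y) = 0) (hy : y ∈ T) :
    lieBivector (gradient g f) π y = 0 := by
  ext j k
  refine eq_zero_of_or (F := fun z => lieBivector (gradient g f) π z j k) (α := α)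
    D.isOpen ?_ ?_ ?_ hy
  · simp only [lieBivector, Matrix.of_apply]
    refine (ContDiffOn.sum fun i _ => ?_ : ContDiffOn ℝ ∞ _ T).continuousOn
    have hX := D.contDiffOn_gradient hf
    have hπ := D.contDiffOn_bivector
    exact (((hX i).mul (contDiffOn_pderiv D.isOpen (hπ j k) i)).sub
      ((hπ i k).mul (contDiffOn_pderiv D.isOpen (hX j) i))).sub
      ((hπ j i).mul (contDiffOn_pderiv D.isOpen (hX k) i))
  · intro z hz
    by_cases hα : α z = 0
    · exact Or.inl hα
    · right
      rw [D.lieBivector_gradient_of_ne_zero h hf hcas hz hα]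
      rfl
  · intro z hz h0
    have hz0 : ∀ i j, ∀ᶠ x in nhds z, π x i j = 0 := by
      intro i j
      filter_upwards [h0, D.isOpen.mem_nhds hz] with x hx hxT
      rw [D.bivector_eq x hxT, hx, smul_zero, crossMatrix_eq_zero_iff.2 rfl]
      rfl
    have h1 : ∀ a i j, pderiv a (fun x => π x i j) z = 0 := fun a i j => by
      rw [pderiv_congr a (h := fun _ => 0) (hz0 i j), pderiv_const]
    have h2 : ∀ i j, π z i j = 0 := fun i j => (hz0 i j).self_of_nhds
    simp [lieBivector, h1, h2]

end IsDualPair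

/-- The Poincaré lemma for smooth 1-forms. -/
theorem exists_potential {n : ℕ} {α : Coord n → Fin n → ℝ} {S : Set (Coord n)} (hS : IsOpen S)
    (hconv : Convex ℝ S) (hα : ∀ k, ContDiffOn ℝ ∞ (fun y => α y k) S)
    (hclosed : ∀ y ∈ S, ∀ i j, pderiv i (fun z => α z j) y = pderiv j (fun z => α z i) y) :
    ∃ f : Coord n → ℝ, ContDiffOn ℝ ∞ f S ∧ ∀ y ∈ S, dFun f y = α y := by
  set θ : Coord n → (Coord n →L[ℝ] ℝ) := fun y =>
    ∑ i, α y i • (EuclideanSpace.proj i : Coord n →L[ℝ] ℝ) with hθ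
  have hθs : ContDiffOn ℝ ∞ θ S := ContDiffOn.sum fun i _ => (hα i).smul contDiffOn_const
  have hθd : DifferentiableOn ℝ θ S := hθs.differentiableOn (by simp)
  have hder : ∀ y ∈ S, ∀ u v, fderiv ℝ θ y u v = ∑ i, fderiv ℝ (fun z => α z i) y u * v i := by
    intro y hy u v
    have hd : ∀ i, DifferentiableAt ℝ (fun z => α z i) y := fun i =>
      differentiableAt_of_contDiffOn (hα i) hS hy
    have := HasFDerivAt.fun_sum (u := Finset.univ) fun i _ =>
      (hd i).hasFDerivAt.smul_const (EuclideanSpace.proj i : Coord n →L[ℝ] ℝ)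
    rw [hθ, this.fderiv]
    simp
  have hexp : ∀ (L : Coord n →L[ℝ] ℝ) (u : Coord n),
      L u = ∑ j, u j * L (EuclideanSpace.single j 1) := by
    intro L u
    conv_lhs => rw [← (EuclideanSpace.basisFun (Fin n) ℝ).sum_repr u]
    simp
  obtain ⟨f, hf⟩ := hconv.exists_forall_hasFDerivAt_of_fderiv_symmetric hS hθd (by
    intro a ha u v
    rw [hder a ha, hder a ha]
    simp only [hexp (fderiv ℝ (fun z => α z _) a) u, hexp (fderiv ℝ (fun z => α z _) a) v,
      Finset.sum_mul]
    rw [Finset.sum_comm]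
    refine Finset.sum_congr rfl fun i _ => Finset.sum_congr rfl fun j _ => ?_
    have := hclosed a ha i j
    simp only [pderiv] at this
    rw [this]
    ring)
  refine ⟨f, ?_, ?_⟩
  -- The potential is smooth because its derivative is the smooth form `θ`.
  · rw [contDiffOn_infty_iff_fderiv_of_isOpen hS]
    exact ⟨fun y hy => (hf y hy).differentiableAt.differentiableWithinAt,
      hθs.congr fun y hy => (hf y hy).fderiv⟩
  · intro y hy
    ext k
    simp [dFun, pderiv, (hf y hy).fderiv, hθ]

namespace IsDualPair

variable {g π : Coord 3 → Matrix (Fin 3) (Fin 3) ℝ} {α : Coord 3 → Fin 3 → ℝ}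
  {w : Coord 3 → ℝ} {T : Set (Coord 3)} {y : Coord 3}

/-- A closed `α` has a potential near each point; it is a Casimir function of `π`. -/
theorem exists_casimir (D : IsDualPair g π α w T) (hext : ∀ y ∈ T, extDerivForm α y = 0)
    (hy : y ∈ T) : ∃ S ⊆ T, IsOpen S ∧ y ∈ S ∧ ∃ f : Coord 3 → ℝ, ContDiffOn ℝ ∞ f S ∧
      ∀ z ∈ S, dFun f z = α z ∧ anchorAt (π z) (dFun f z) = 0 := by
  obtain ⟨r, hr, hrT⟩ := Metric.isOpen_iff.1 D.isOpen y hy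
  obtain ⟨f, hf, hdf⟩ := exists_potential Metric.isOpen_ball (convex_ball y r)
    (fun k => (D.contDiffOn_form k).mono hrT)
    (fun z hz => extDerivForm_eq_zero_iff.1 (hext z (hrT hz)))
  refine ⟨_, hrT, Metric.isOpen_ball, Metric.mem_ball_self hr, f, hf, fun z hz => ⟨hdf z hz, ?_⟩⟩
  rw [D.casimir_iff (hrT hz), hdf z hz]
  exact fun i j => mul_comm _ _

theorem lieBivector_congr {X Y : Coord 3 → Fin 3 → ℝ} (h : X =ᶠ[nhds y] Y) :
    lieBivector X π y = lieBivector Y π y := by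
  have h1 : ∀ i j, pderiv i (fun z => X z j) y = pderiv i (fun z => Y z j) y := fun i j =>
    pderiv_congr i (h.mono fun z hz => congrFun hz j)
  ext j k
  simp only [lieBivector, Matrix.of_apply, h1, h.self_of_nhds]

end IsDualPair

/-! ### Coordinate frames of charts -/

section Charts

variable {n : ℕ} {M : Type*} [TopologicalSpace M] [ChartedSpace (Coord n) M]
  {e : OpenPartialHomeomorph M (Coord n)} {y : Coord n}

theorem BivectorField.comp_antisymm (π : BivectorField n M) (e : OpenPartialHomeomorph M (Coord n))
    (y : Coord n) (i j : Fin n) : π.comp e y i j = -π.comp e y j i := by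
  have h := π.alternating (e.symm y) (coordCovec e y i + coordCovec e y j)
  simp only [map_add, LinearMap.add_apply, π.alternating, zero_add, add_zero] at h
  simp only [BivectorField.comp, Matrix.of_apply]
  linarith

/-- A continuous map to the discrete `SignType` is locally constant. -/
theorem ManifoldOrientation.contDiffOn_sign (o : ManifoldOrientation n M)
    (he : e ∈ atlas (Coord n) M) : ContDiffOn ℝ ∞ (o.sign e) e.target := by
  intro y hy
  have h := (o.continuous_sign e he).continuousAt (e.open_target.mem_nhds hy)
  have h1 : ∀ᶠ z in nhds y, o.sign e z = o.sign e y := by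
    have := h.eventually (mem_nhds_discrete.2 rfl : {s | s = _} ∈ nhds _)
    filter_upwards [this] with z hz
    simp only [ManifoldOrientation.sign]
    rw [hz]
  exact (contDiffAt_const.congr_of_eventuallyEq h1).contDiffWithinAt

variable [IsManifold (𝓡 n) ∞ M]

theorem mdifferentiable_of_mem_atlas_smooth (he : e ∈ atlas (Coord n) M) :
    e.MDifferentiable (𝓡 n) (𝓡 n) :=
  haveI : IsManifold (𝓡 n) 1 M := IsManifold.of_le (n := ∞) (by simp)
  mdifferentiable_of_mem_atlas he

theorem mfderiv_symm_bijective (he : e ∈ atlas (Coord n) M) (hy : y ∈ e.target) :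
    Function.Bijective (mfderiv (𝓡 n) (𝓡 n) e.symm y) :=
  (mdifferentiable_of_mem_atlas_smooth he).symm.mfderiv_bijective hy

/-- The linear isomorphism of the coordinate space with the tangent space, given by a chart. -/
def frameEquiv (he : e ∈ atlas (Coord n) M) (hy : y ∈ e.target) :
    TangentSpace (𝓡 n) y ≃ₗ[ℝ] TangentSpace (𝓡 n) (e.symm y) :=
  LinearEquiv.ofBijective (mfderiv (𝓡 n) (𝓡 n) e.symm y).toLinearMap
    (mfderiv_symm_bijective he hy)

/-- The coordinate frame as a basis. -/
def frameBasis (he : e ∈ atlas (Coord n) M) (hy : y ∈ e.target) :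
    Module.Basis (Fin n) ℝ (TangentSpace (𝓡 n) (e.symm y)) :=
  let b : Module.Basis (Fin n) ℝ (TangentSpace (𝓡 n) y) :=
    (EuclideanSpace.basisFun (Fin n) ℝ).toBasis
  b.map (frameEquiv he hy)

theorem frameBasis_apply (he : e ∈ atlas (Coord n) M) (hy : y ∈ e.target) (i : Fin n) :
    frameBasis he hy i = coordVec e y i := by
  have h : ((EuclideanSpace.basisFun (Fin n) ℝ).toBasis i : Coord n) = EuclideanSpace.single i 1 := by
    simp
  rw [coordVec, ← h]
  rfl

theorem coe_frameBasis (he : e ∈ atlas (Coord n) M) (hy : y ∈ e.target) :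
    ⇑(frameBasis he hy) = coordVec e y :=
  funext (frameBasis_apply he hy)

theorem mvfderiv_coordVec (he : e ∈ atlas (Coord n) M) (hy : y ∈ e.target) {u : M → ℝ}
    (hu : DifferentiableAt ℝ (fun z => u (e.symm z)) y) (i : Fin n) :
    mvfderiv (𝓡 n) u (e.symm y) (coordVec e y i) = pderiv i (fun z => u (e.symm z)) y := by
  have hE := mdifferentiable_of_mem_atlas_smooth he
  have hxs : e.symm y ∈ e.source := e.map_target hy
  -- Near the point, `u` is its coordinate expression composed with `e`.
  have hmu : MDifferentiableAt (𝓡 n) 𝓘(ℝ, ℝ) u (e.symm y) := by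
    have h1 : MDifferentiableAt (𝓡 n) 𝓘(ℝ, ℝ) ((fun z => u (e.symm z)) ∘ e) (e.symm y) := by
      refine MDifferentiableAt.comp (I' := 𝓡 n) _ ?_ (hE.mdifferentiableAt hxs)
      rw [e.right_inv hy]
      exact hu.mdifferentiableAt
    refine h1.congr_of_eventuallyEq ?_
    filter_upwards [e.open_source.mem_nhds hxs] with x hx
    simp [e.left_inv hx]
  have h2 := mfderiv_comp y hmu (hE.mdifferentiableAt_symm hy)
  have h3 : pderiv i (fun z => u (e.symm z)) y
      = mfderiv (𝓡 n) 𝓘(ℝ, ℝ) (u ∘ e.symm) y (EuclideanSpace.single i 1 : Coord n) := by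
    rw [mfderiv_eq_fderiv]
    rfl
  rw [h3, h2]
  rfl

theorem coordCovec_coordVec (he : e ∈ atlas (Coord n) M) (hy : y ∈ e.target) (i j : Fin n) :
    coordCovec e y i (coordVec e y j) = if i = j then 1 else 0 := by
  have hev : (fun z => e (e.symm z) i) =ᶠ[nhds y] fun z => z i := by
    filter_upwards [e.open_target.mem_nhds hy] with z hz
    rw [e.right_inv hz]
  have hd : DifferentiableAt ℝ (fun z : Coord n => z i) y := by fun_prop
  rw [coordCovec, mvfderiv_coordVec he hy (hd.congr_of_eventuallyEq hev), pderiv_congr j hev]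
  have : fderiv ℝ (fun z : Coord n => z i) y = (EuclideanSpace.proj i : Coord n →L[ℝ] ℝ) :=
    (EuclideanSpace.proj i : Coord n →L[ℝ] ℝ).fderiv
  simp [pderiv, this]

theorem covector_eq_sum (he : e ∈ atlas (Coord n) M) (hy : y ∈ e.target)
    (β : TangentSpace (𝓡 n) (e.symm y) →L[ℝ] ℝ) :
    β = ∑ i, β (coordVec e y i) • coordCovec e y i := by
  have : (β : TangentSpace (𝓡 n) (e.symm y) →ₗ[ℝ] ℝ)
      = ((∑ i, β (coordVec e y i) • coordCovec e y i : TangentSpace (𝓡 n) (e.symm y) →L[ℝ] ℝ) :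
        TangentSpace (𝓡 n) (e.symm y) →ₗ[ℝ] ℝ) := by
    refine (frameBasis he hy).ext fun j => ?_
    simp [frameBasis_apply, coordCovec_coordVec he hy]
  exact ContinuousLinearMap.coe_injective this

theorem BivectorField.apply_eq_bilin (π : BivectorField n M) (he : e ∈ atlas (Coord n) M)
    (hy : y ∈ e.target) (β γ : TangentSpace (𝓡 n) (e.symm y) →L[ℝ] ℝ) :
    π.toFun (e.symm y) β γ = bilin (π.comp e y) (fun i => β (coordVec e y i))
      (fun i => γ (coordVec e y i)) := by
  conv_lhs => rw [covector_eq_sum he hy β, covector_eq_sum he hy γ]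
  simp only [map_sum, map_smul, LinearMap.sum_apply, LinearMap.smul_apply, smul_eq_mul, bilin,
    BivectorField.comp, Matrix.of_apply, Finset.mul_sum]
  rw [Finset.sum_comm]
  refine Finset.sum_congr rfl fun _ _ => Finset.sum_congr rfl fun _ _ => ?_
  ring

theorem contDiffOn_comp_symm (he : e ∈ atlas (Coord n) M) {f : M → ℝ} {U : Set M}
    (hf : ContMDiffOn (𝓡 n) 𝓘(ℝ, ℝ) ∞ f U) :
    ContDiffOn ℝ ∞ (fun z => f (e.symm z)) (e.target ∩ e.symm ⁻¹' U) := by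
  have h := contMDiffOn_symm_of_mem_maximalAtlas (I := 𝓡 n) (n := ∞)
    (IsManifold.subset_maximalAtlas he)
  exact (hf.comp (h.mono Set.inter_subset_left) (fun z hz => hz.2)).contDiffOn

theorem contMDiffOn_comp (he : e ∈ atlas (Coord n) M) {F : Coord n → ℝ} {S : Set (Coord n)}
    (hF : ContDiffOn ℝ ∞ F S) :
    ContMDiffOn (𝓡 n) 𝓘(ℝ, ℝ) ∞ (fun x => F (e x)) (e.source ∩ e ⁻¹' S) := by
  have h := contMDiffOn_of_mem_maximalAtlas (I := 𝓡 n) (n := ∞)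
    (IsManifold.subset_maximalAtlas he)
  exact hF.contMDiffOn.comp (h.mono Set.inter_subset_left) (fun z hz => hz.2)

/-- The coordinate fields are the images of constant fields under the tangent map of `e.symm`. -/
theorem contMDiffOn_coordVec (he : e ∈ atlas (Coord n) M) (i : Fin n) :
    ContMDiffOn (𝓡 n) (𝓡 n).tangent ∞
      (fun y => (⟨e.symm y, coordVec e y i⟩ : TangentBundle (𝓡 n) M)) e.target := by
  have h := contMDiffOn_symm_of_mem_maximalAtlas (I := 𝓡 n) (n := ∞)
    (IsManifold.subset_maximalAtlas he)
  have ht := h.contMDiffOn_tangentMapWithin (m := ∞) (by simp)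
    e.open_target.uniqueMDiffOn
  have hs : ContMDiffOn (𝓡 n) (𝓡 n).tangent ∞
      (fun y => (⟨y, (EuclideanSpace.single i 1 : Coord n)⟩ : TangentBundle (𝓡 n) (Coord n)))
      e.target := by
    intro y _
    exact contMDiffWithinAt_vectorSpace_iff_contDiffWithinAt.2 contDiffWithinAt_const
  have hc := ht.comp hs (fun y hy => hy)
  refine hc.congr fun y hy => ?_
  simp only [Function.comp, tangentMapWithin, coordVec]
  rw [mfderivWithin_of_isOpen e.open_target hy]

theorem contDiffOn_metricComp
    (g : Bundle.ContMDiffRiemannianMetric (𝓡 n) ∞ (Coord n)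
      (fun x : M => TangentSpace (𝓡 n) x)) (he : e ∈ atlas (Coord n) M) (i j : Fin n) :
    ContDiffOn ℝ ∞ (fun y => metricComp g e y i j) e.target := by
  have h := contMDiffOn_symm_of_mem_maximalAtlas (I := 𝓡 n) (n := ∞)
    (IsManifold.subset_maximalAtlas he)
  have hg := g.contMDiff.comp_contMDiffOn h
  -- The metric, a smooth section of a bundle of bilinear maps, is evaluated on the coordinate
  -- fields.
  have := ContMDiffOn.clm_bundle_apply₂ (F₁ := Coord n) (F₂ := Coord n) (F₃ := ℝ)
    (E₁ := fun x : M => TangentSpace (𝓡 n) x) (E₂ := fun x : M => TangentSpace (𝓡 n) x)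
    (E₃ := Bundle.Trivial M ℝ) hg (contMDiffOn_coordVec he i) (contMDiffOn_coordVec he j)
  rw [← contMDiffOn_iff_contDiffOn]
  intro y hy
  have h2 := this y hy
  simp only [Bundle.contMDiffWithinAt_totalSpace] at h2
  exact h2.2

theorem posDef_metricComp
    (g : Bundle.ContMDiffRiemannianMetric (𝓡 n) ∞ (Coord n)
      (fun x : M => TangentSpace (𝓡 n) x)) (he : e ∈ atlas (Coord n) M) (hy : y ∈ e.target) :
    (metricComp g e y).PosDef := by
  refine Matrix.PosDef.of_dotProduct_mulVec_pos ?_ ?_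
  · ext i j
    simp [metricComp, g.symm _ (coordVec e y i)]
  · intro u hu
    have hv : ∑ i, u i • coordVec e y i ≠ 0 := by
      intro h
      have := Fintype.linearIndependent_iff.1 (frameBasis he hy).linearIndependent u
        (by simpa [frameBasis_apply] using h)
      exact hu (funext this)
    have := g.pos _ _ hv
    simp only [map_sum, map_smul, sum_apply, smul_apply,
      smul_eq_mul] at this
    simp only [dotProduct, Matrix.mulVec, star_trivial, metricComp, Matrix.of_apply,
      Finset.mul_sum] at this ⊢
    refine this.trans_eq ?_
    rw [Finset.sum_comm]
    refine Finset.sum_congr rfl fun _ _ => Finset.sum_congr rfl fun _ _ => ?_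
    ring

theorem ManifoldOrientation.sign_sq (o : ManifoldOrientation n M) (he : e ∈ atlas (Coord n) M)
    (hy : y ∈ e.target) : o.sign e y ^ 2 = 1 := by
  have h : (o.orient (e.symm y)).someVector (coordVec e y) ≠ 0 := by
    rw [← coe_frameBasis he hy, Ne, AlternatingMap.map_basis_eq_zero_iff]
    exact Module.Ray.someVector_ne_zero _
  unfold ManifoldOrientation.sign
  rcases lt_or_gt_of_ne h with h | h
  · simp [sign_neg h]
  · simp [sign_pos h]

end Charts

/-! ### Killing–Poisson tensors -/

theorem BivectorField.bracket_symm_apply {n : ℕ} {M : Type*} [TopologicalSpace M]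
    [ChartedSpace (Coord n) M] [IsManifold (𝓡 n) ∞ M] (π : BivectorField n M)
    {e : OpenPartialHomeomorph M (Coord n)} (he : e ∈ atlas (Coord n) M) {y : Coord n}
    (hy : y ∈ e.target) {f h : M → ℝ}
    (hf : DifferentiableAt ℝ (fun z => f (e.symm z)) y)
    (hh : DifferentiableAt ℝ (fun z => h (e.symm z)) y) :
    π.bracket f h (e.symm y) = bilin (π.comp e y) (dFun (fun z => f (e.symm z)) y)
      (dFun (fun z => h (e.symm z)) y) := by
  rw [BivectorField.bracket, π.apply_eq_bilin he hy]
  simp only [mvfderiv_coordVec he hy hf, mvfderiv_coordVec he hy hh]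
  rfl

theorem bilin_eq_sum_anchorAt {n : ℕ} (p : Matrix (Fin n) (Fin n) ℝ) (u v : Fin n → ℝ) :
    bilin p u v = ∑ j, anchorAt p u j * v j := by
  simp only [bilin, anchorAt, Finset.sum_mul]
  exact Finset.sum_comm

/-! ### From charts of the 3-manifold to dual pairs -/

section Dimension3

variable {M : Type*} [TopologicalSpace M] [ChartedSpace (Coord 3) M] [IsManifold (𝓡 3) ∞ M]
  {o : ManifoldOrientation 3 M}
  {g : Bundle.ContMDiffRiemannianMetric (𝓡 3) ∞ (Coord 3) (fun x : M => TangentSpace (𝓡 3) x)}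
  {π : BivectorField 3 M} {e : OpenPartialHomeomorph M (Coord 3)}

/-- Each unordered index pair occurs twice in the double sum, cancelling the factor `1/2`. -/
theorem dualForm_apply (y : Coord 3) :
    dualForm o g π e y = (o.sign e y * √(metricComp g e y).det) •
      ![π.comp e y 1 2, π.comp e y 2 0, π.comp e y 0 1] := by
  have h := π.comp_antisymm e y
  have h1 := h 1 0
  have h2 := h 0 2
  have h3 := h 2 1
  have d : ∀ i, π.comp e y i i = 0 := fun i => by linarith [h i i]
  ext k
  fin_cases k <;>
    simp [dualForm, volumeComp, leviCivita, Fin.sum_univ_three, Matrix.det_fin_three, h1, h2, h3,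
      d] <;> ring

/-- The density is the inverse of the factor `± √(det g)` in `α = i_π μ`, since the sign squares to
1; hence `w ∗ α` returns `π`. -/
theorem isDualPair (o : ManifoldOrientation 3 M)
    (g : Bundle.ContMDiffRiemannianMetric (𝓡 3) ∞ (Coord 3)
      (fun x : M => TangentSpace (𝓡 3) x)) (π : BivectorField 3 M)
    (he : e ∈ atlas (Coord 3) M) :
    IsDualPair (metricComp g e) (π.comp e) (dualForm o g π e)
      (fun y => o.sign e y * (√(metricComp g e y).det)⁻¹) e.target := by
  have hg := contDiffOn_metricComp g he
  have hpos : ∀ y ∈ e.target, 0 < (metricComp g e y).det := fun y hy =>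
    (posDef_metricComp g he hy).det_pos
  have hsqrt : ContDiffOn ℝ ∞ (fun y => √(metricComp g e y).det) e.target := by
    refine ContDiffOn.sqrt ?_ fun y hy => (hpos y hy).ne'
    simp only [Matrix.det_fin_three]
    fun_prop
  have hsqrt0 : ∀ y ∈ e.target, √(metricComp g e y).det ≠ 0 := fun y hy =>
    (Real.sqrt_pos.2 (hpos y hy)).ne'
  have hs := o.contDiffOn_sign he
  have hπ : ∀ i j, ContDiffOn ℝ ∞ (fun y => π.comp e y i j) e.target := π.smooth e he
  refine ⟨e.open_target, hg, fun y hy => posDef_metricComp g he hy, hs.mul (hsqrt.inv hsqrt0),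
    fun k => ?_, fun y hy => ?_, fun y hy => ?_⟩
  · simp only [dualForm_apply, Pi.smul_apply, smul_eq_mul]
    refine (hs.mul hsqrt).mul ?_
    fin_cases k
    exacts [hπ 1 2, hπ 2 0, hπ 0 1]
  · rw [mul_pow, o.sign_sq he hy, inv_pow, Real.sq_sqrt (hpos y hy).le, one_mul,
      inv_mul_cancel₀ (hpos y hy).ne']
  · have h1 : (o.sign e y * (√(metricComp g e y).det)⁻¹) * (o.sign e y * √(metricComp g e y).det)
        = 1 := by
      have := o.sign_sq he hy
      field_simp [hsqrt0 y hy]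
      exact this
    rw [dualForm_apply, smul_smul, h1, one_smul]
    have h := π.comp_antisymm e y
    have d : ∀ i, π.comp e y i i = 0 := fun i => by linarith [h i i]
    ext i j
    fin_cases i <;> fin_cases j <;> simp [crossMatrix, d]
    exacts [h 0 2, h 1 0, h 2 1]

theorem IsKillingPoisson.dual_equations (hK : IsKillingPoisson g π) (he : e ∈ atlas (Coord 3) M)
    {y : Coord 3} (hy : y ∈ e.target) :
    extDerivForm (dualForm o g π e) y = 0 ∧
      dFun (cometric (metricComp g e) (dualForm o g π e) (dualForm o g π e)) y
        + codifferential (metricComp g e) (dualForm o g π e) y • dualForm o g π e y = 0 := by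
  have D := isDualPair o g π he
  have hext : ∀ z ∈ e.target, extDerivForm (dualForm o g π e) z = 0 := fun z hz =>
    (D.divBivector_eq_zero_iff hz).1 (hK.div_eq_zero e he z hz)
  refine ⟨hext y hy, ?_⟩
  rw [← D.lieBivector_sharp_eq_zero_iff hy (hext y hy)]
  -- Transported to `M` by the chart, `F` is a Casimir function on an open set, with gradient `#α`
  -- there.
  obtain ⟨S, hST, hS, hyS, F, hF, hFα⟩ := D.exists_casimir hext hy
  have hcongr : ∀ z ∈ S, (fun z => F (e (e.symm z))) =ᶠ[nhds z] F := by
    intro z hz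
    filter_upwards [e.open_target.mem_nhds (hST hz)] with x hx
    rw [e.right_inv hx]
  have hdF : ∀ z ∈ S, dFun (fun z => F (e (e.symm z))) z = dFun F z := fun z hz =>
    funext fun i => pderiv_congr i (hcongr z hz)
  have hcas : π.IsCasimirOn (fun x => F (e x)) (e.source ∩ e ⁻¹' S) := by
    rintro x ⟨hxe, hxS⟩
    obtain ⟨z, hz, rfl⟩ : ∃ z ∈ e.target, e.symm z = x := ⟨e x, e.map_source hxe, e.left_inv hxe⟩
    rw [Set.mem_preimage, e.right_inv hz] at hxS
    intro β
    have hd : DifferentiableAt ℝ (fun z => F (e (e.symm z))) z :=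
      (differentiableAt_of_contDiffOn hF hS hxS).congr_of_eventuallyEq (hcongr z hxS)
    rw [π.apply_eq_bilin he hz, bilin_eq_sum_anchorAt]
    simp only [mvfderiv_coordVec (u := fun x => F (e x)) he hz hd]
    have h0 : anchorAt (π.comp e z) (fun i => pderiv i (fun z => F (e (e.symm z))) z) = 0 := by
      rw [← (hFα z hxS).2, ← hdF z hxS]
      rfl
    simp [h0]
  have hL := hK.lie_gradient_eq_zero _ _ (e.isOpen_inter_preimage hS) (contMDiffOn_comp he hF)
    hcas e he y hy ⟨e.map_target hy, by simpa [e.right_inv hy] using hyS⟩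
  rw [← hL]
  refine IsDualPair.lieBivector_congr ?_
  filter_upwards [hS.mem_nhds hyS] with z hz
  simp only [gradient]
  unfold sharp
  rw [hdF z hz, (hFα z hz).1]

theorem isKillingPoisson_of_dual_equations
    (h : ∀ e ∈ atlas (Coord 3) M, ∀ y ∈ e.target,
      extDerivForm (dualForm o g π e) y = 0 ∧
        dFun (cometric (metricComp g e) (dualForm o g π e) (dualForm o g π e)) y
          + codifferential (metricComp g e) (dualForm o g π e) y • dualForm o g π e y = 0) :
    IsKillingPoisson g π where
  isPoisson f₁ f₂ f₃ h₁ h₂ h₃ x := by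
    have he := chart_mem_atlas (Coord 3) x
    obtain ⟨y, hy, hyx⟩ : ∃ y ∈ (chartAt (Coord 3) x).target, (chartAt (Coord 3) x).symm y = x :=
      ⟨_, mem_chart_target _ x, (chartAt (Coord 3) x).left_inv (mem_chart_source _ x)⟩
    generalize chartAt (Coord 3) x = e at *
    have D := isDualPair o g π he
    rw [← hyx]
    have hsm : ∀ {u : M → ℝ}, ContMDiff (𝓡 3) 𝓘(ℝ, ℝ) ∞ u →
        ContDiffOn ℝ ∞ (fun z => u (e.symm z)) e.target := fun hu => by
      simpa using contDiffOn_comp_symm he (hu.contMDiffOn (s := Set.univ))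
    have hdf : ∀ {u : M → ℝ}, ContMDiff (𝓡 3) 𝓘(ℝ, ℝ) ∞ u → ∀ z ∈ e.target,
        DifferentiableAt ℝ (fun z => u (e.symm z)) z := fun hu z hz =>
      differentiableAt_of_contDiffOn (hsm hu) D.isOpen hz
    -- The inner bracket gets differentiated, so its coordinate formula is needed on a neighbourhood
    -- of `y`.
    have hbr : ∀ {u v : M → ℝ}, ContMDiff (𝓡 3) 𝓘(ℝ, ℝ) ∞ u → ContMDiff (𝓡 3) 𝓘(ℝ, ℝ) ∞ v →
        (fun z => π.bracket u v (e.symm z)) =ᶠ[nhds y] fun z =>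
          bilin (π.comp e z) (dFun (fun z => u (e.symm z)) z) (dFun (fun z => v (e.symm z)) z) := by
      intro u v hu hv
      filter_upwards [D.isOpen.mem_nhds hy] with z hz
      exact π.bracket_symm_apply he hz (hdf hu z hz) (hdf hv z hz)
    have hbd : ∀ {u v : M → ℝ}, ContMDiff (𝓡 3) 𝓘(ℝ, ℝ) ∞ u → ContMDiff (𝓡 3) 𝓘(ℝ, ℝ) ∞ v →
        DifferentiableAt ℝ (fun z => π.bracket u v (e.symm z)) y := by
      intro u v hu hv
      refine DifferentiableAt.congr_of_eventuallyEq ?_ (hbr hu hv)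
      have hπ := D.differentiableAt_bivector hy
      have hu' := fun i => differentiableAt_of_contDiffOn
        (contDiffOn_pderiv D.isOpen (hsm hu) i) D.isOpen hy
      have hv' := fun i => differentiableAt_of_contDiffOn
        (contDiffOn_pderiv D.isOpen (hsm hv) i) D.isOpen hy
      simp only [bilin, dFun]
      fun_prop
    have hd : ∀ {u v : M → ℝ}, ContMDiff (𝓡 3) 𝓘(ℝ, ℝ) ∞ u → ContMDiff (𝓡 3) 𝓘(ℝ, ℝ) ∞ v →
        dFun (fun z => π.bracket u v (e.symm z)) y = dFun (fun z => bilin (π.comp e z)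
          (dFun (fun z => u (e.symm z)) z) (dFun (fun z => v (e.symm z)) z)) y := fun hu hv =>
      funext fun i => pderiv_congr i (hbr hu hv)
    rw [π.bracket_symm_apply he hy (hdf h₁ y hy) (hbd h₂ h₃),
      π.bracket_symm_apply he hy (hdf h₂ y hy) (hbd h₃ h₁),
      π.bracket_symm_apply he hy (hdf h₃ y hy) (hbd h₁ h₂), hd h₂ h₃, hd h₃ h₁, hd h₁ h₂]
    have hca : ∀ {u : M → ℝ}, ContMDiff (𝓡 3) 𝓘(ℝ, ℝ) ∞ u →
        ContDiffAt ℝ ∞ (fun z => u (e.symm z)) y := fun hu =>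
      (hsm hu).contDiffAt (D.isOpen.mem_nhds hy)
    exact D.jacobi hy (h e he y hy).1 (hca h₁) (hca h₂) (hca h₃)
  div_eq_zero e he y hy := ((isDualPair o g π he).divBivector_eq_zero_iff hy).2 (h e he y hy).1
  lie_gradient_eq_zero U f hU hf hcas e he y hy hyU := by
    have hS : IsOpen (e.target ∩ e.symm ⁻¹' U) := e.isOpen_inter_preimage_symm hU
    have D := (isDualPair o g π he).mono hS Set.inter_subset_left
    have hfs := contDiffOn_comp_symm he hf
    refine D.lieBivector_gradient_eq_zero (fun z hz => h e he z hz.1) hfs (fun z hz => ?_) ⟨hy, hyU⟩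
    ext j
    have hd := differentiableAt_of_contDiffOn hfs hS hz
    -- Testing the Casimir condition on `dxʲ` gives the component `j` of the Hamiltonian field.
    have h0 := hcas (e.symm z) hz.2 (coordCovec e z j)
    rw [π.apply_eq_bilin he hz.1, bilin_eq_sum_anchorAt] at h0
    simp only [mvfderiv_coordVec he hz.1 hd, coordCovec_coordVec he hz.1] at h0
    change anchorAt (π.comp e z) (fun i => pderiv i (fun z => f (e.symm z)) z) j = 0
    simpa using h0

end Dimension3

end KillingPoisson

end

theorem theorem5p1 {M : Type*} [TopologicalSpace M] [T2Space M] [SecondCountableTopology M]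
    [ChartedSpace (KillingPoisson.Coord 3) M] [IsManifold (𝓡 3) ∞ M]
    (o : KillingPoisson.ManifoldOrientation 3 M)
    (g : Bundle.ContMDiffRiemannianMetric (𝓡 3) ∞ (KillingPoisson.Coord 3)
      (fun x : M => TangentSpace (𝓡 3) x))
    (π : KillingPoisson.BivectorField 3 M) :
    List.TFAE [
      KillingPoisson.IsKillingPoisson g π,
      KillingPoisson.IsContravariantParallel g π,
      ∀ e ∈ atlas (KillingPoisson.Coord 3) M, ∀ y ∈ e.target,
        KillingPoisson.extDerivForm (KillingPoisson.dualForm o g π e) y = 0 ∧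
        KillingPoisson.dFun (KillingPoisson.cometric (KillingPoisson.metricComp g e)
            (KillingPoisson.dualForm o g π e) (KillingPoisson.dualForm o g π e)) y
          + KillingPoisson.codifferential (KillingPoisson.metricComp g e)
              (KillingPoisson.dualForm o g π e) y • KillingPoisson.dualForm o g π e y = 0] := by
  tfae_have 1 → 3 := fun h e he y hy => h.dual_equations he hy
  tfae_have 3 → 1 := KillingPoisson.isKillingPoisson_of_dual_equations
  tfae_have 2 ↔ 3 :=
    forall₂_congr fun e he => (KillingPoisson.isDualPair o g π he).parallel_iff
  tfae_finish
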